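/- There are a deterministic algorithm (computable, and one and the same for all inputs) and an absolute constant $C$ such that the following holds. Let $n\ge 0$, let $\varepsilon>0$ be rational, and let $\mathcal M_1=(V,\mathcal I_1)$ and $\mathcal M_2=(V,\mathcal I_2)$ be matroids on the common ground set $V=\{0,\dots,n-1\}$. Let $r$ be the maximum of $|S|$ over all $S\in\mathcal I_1\cap\mathcal I_2$. Given $n$ and $\varepsilon$ (as a fraction of positive integers), and with access to the matroids only through independence queries of the form "is $X\in\mathcal I_1$?" or "is $X\in\mathcal I_2$?" with $X\subseteq V$, the algorithm halts and returns a common independent set $S\in\mathcal I_1\cap\mathcal I_2$ with $$|S|\ge(1-\varepsilon)\,r,$$ after at most $$C\cdot\frac{n\sqrt{\max(1,\;r\log r)}}{\varepsilon}$$ independence queries; here $\log$ is the natural logarithm and $0\log 0=0$. In particular, for $r\ge 2$ it uses $O\!\left(\frac{n\sqrt{r\log r}}{\varepsilon}\right)$ independence queries. -/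

import Mathlib

/-- The subset of the ground set `{0, …, n - 1}` that a list of natural numbers describes. -/
def listedSet (n : ℕ) (L : List ℕ) : Finset (Fin n) :=
  Finset.univ.filter fun v => (v : ℕ) ∈ L

/-- A deterministic algorithm for matroid intersection in the independence-oracle model.
The input is `(n, p, q)`: the ground set is `{0, …, n - 1}` and the accuracy is `ε = p / q`. The two
matroids are accessible only through their oracles. From the input and the list of the oracle
answers received so far (most recent answer first), the algorithm computes its next action:
* `Sum.inl (false, L)`: ask whether the set listed by `L` is independent in the first matroid;
* `Sum.inl (true, L)`: ask whether the set listed by `L` is independent in the second matroid;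
* `Sum.inr L`: stop and return the set listed by `L`.
This is one uniform algorithm for all inputs, and it is effective: the next action is a total
computable function of the input and the answers. -/
structure OracleAlgorithm where
  next : (ℕ × ℕ × ℕ) × List Bool → (Bool × List ℕ) ⊕ List ℕ
  computable_next : Computable next

namespace OracleAlgorithm

/-- `A.RunsTo p q M₁ M₂ h k S`: on the input `(n, p, q)`, with the oracles of `M₁` and `M₂`, and
having already received the answers `h`, the algorithm `A` asks exactly `k` further independence
queries, then stops and returns the set `S`. Every query is counted, repeated ones too. -/
inductive RunsTo (A : OracleAlgorithm) {n : ℕ} (p q : ℕ) (M₁ M₂ : Matroid (Fin n)) :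
    List Bool → ℕ → Finset (Fin n) → Prop
  | output (h : List Bool) (L : List ℕ)
      (hnext : A.next ((n, p, q), h) = Sum.inr L) :
      RunsTo A p q M₁ M₂ h 0 (listedSet n L)
  | query₁ (h : List Bool) (L : List ℕ) (answer : Bool) (k : ℕ) (S : Finset (Fin n))
      (hnext : A.next ((n, p, q), h) = Sum.inl (false, L))
      (hanswer : answer = true ↔ M₁.Indep (listedSet n L : Set (Fin n)))
      (hrest : RunsTo A p q M₁ M₂ (answer :: h) k S) :
      RunsTo A p q M₁ M₂ h (k + 1) S
  | query₂ (h : List Bool) (L : List ℕ) (answer : Bool) (k : ℕ) (S : Finset (Fin n))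
      (hnext : A.next ((n, p, q), h) = Sum.inl (true, L))
      (hanswer : answer = true ↔ M₂.Indep (listedSet n L : Set (Fin n)))
      (hrest : RunsTo A p q M₁ M₂ (answer :: h) k S) :
      RunsTo A p q M₁ M₂ h (k + 1) S

end OracleAlgorithm

/-- `r` is the size of a largest common independent set of `M₁` and `M₂`. -/
def IsMaxCommonIndepSize {n : ℕ} (M₁ M₂ : Matroid (Fin n)) (r : ℕ) : Prop :=
  IsGreatest {k : ℕ | ∃ S : Finset (Fin n),
    M₁.Indep (S : Set (Fin n)) ∧ M₂.Indep (S : Set (Fin n)) ∧ S.card = k} r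

/-! The bound comes from playing two strategies against each other, both written as decision trees
so that queries can be counted.

The auction (`auction_spec`) gives every element a level below `k`, or retires it at `k` or above,
and keeps a set `S` such that each level of `S` is independent over the lower levels in the first
matroid, while everything above a level is spanned in the second matroid by the part of `S` from
that level up. Each level threshold then yields a rank-covering bound on a common independent set;
averaging these bounds (`Inv.mul_card_le`) shows that `S` is nearly optimal once the first matroid
has little rank below level `k` beyond `S`. A bounded potential (`round_spec`) makes this happen
within `2 * k ^ 2` rounds of at most `4 * n` queries. The error is about `2 / k` at a cost of order
`n * k ^ 2`.

Augmentation (`improve_spec`) searches breadth-first for an exchange that enlarges `S`. A failed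
layer reaches at least `r - |S|` new elements of `S` (`layer_spec`), so failure of `k` layers forces
`k * (r - |S|) ≤ |S|`. With binary search for exchange partners, a search costs of order `n * k *
log r`.

`solve` first finds `s` with `s ≤ r ≤ 2 * s` by a coarse auction. Let `x` be about `√(s log s)`. If
`1 / ε` is at most of order `x`, an auction with about `2 / ε` levels suffices. Otherwise an auction
with `x + 1` levels leaves a deficit of order `r / x`, and that many augmentations with about `2 /
ε` layers cost of order `n * r * log r / (x * ε)`, which is again of order `n * x / ε`.

Only queries are counted, so computability is obtained separately: the algorithm searches for a
finite answer table and verifies it against all pairs of matroids on `{0, …, n - 1}`. The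
verification is primitive recursive, and `solve` itself provides a table that passes. -/

/-- An adaptive query strategy with results in `α` for a pair of matroids on `Fin n`: a decision
tree whose inner nodes ask for the independence of a set in one of the two matroids. -/
inductive QTree (n : ℕ) (α : Type) : Type
  | ret (a : α) : QTree n α
  | ask (b : Bool) (X : Finset (Fin n)) (k : Bool → QTree n α) : QTree n α

/-! ### Decision trees: results, query counts and folds. -/

namespace QTree

variable {n : ℕ} {α β σ : Type}

open Classical in
/-- The result of a strategy on the matroids `M false` and `M true`. -/
noncomputable def val (M : Bool → Matroid (Fin n)) : QTree n α → α
  | ret a => a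
  | ask b X k => (k (decide ((M b).Indep (X : Set (Fin n))))).val M

open Classical in
/-- The number of queries that a strategy asks on the matroids `M false` and `M true`. -/
noncomputable def cost (M : Bool → Matroid (Fin n)) : QTree n α → ℕ
  | ret _ => 0
  | ask b X k => (k (decide ((M b).Indep (X : Set (Fin n))))).cost M + 1

/-- Run one strategy and continue with another one that depends on its result. -/
def bind : QTree n α → (α → QTree n β) → QTree n β
  | ret a, f => f a
  | ask b X k, f => ask b X fun a => (k a).bind f

/-- The left fold of a strategy along a list. -/
def fold (f : σ → β → QTree n σ) : σ → List β → QTree n σ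
  | s, [] => ret s
  | s, b :: L => (f s b).bind fun s' => fold f s' L

variable (M : Bool → Matroid (Fin n))

@[simp] theorem val_ret (a : α) : (ret a : QTree n α).val M = a := rfl

@[simp] theorem cost_ret (a : α) : (ret a : QTree n α).cost M = 0 := rfl

theorem val_ask_of_indep {b : Bool} {X : Finset (Fin n)} (k : Bool → QTree n α)
    (h : (M b).Indep (X : Set (Fin n))) : (ask b X k).val M = (k true).val M := by
  simp [val, h]

theorem val_ask_of_not_indep {b : Bool} {X : Finset (Fin n)} (k : Bool → QTree n α)
    (h : ¬ (M b).Indep (X : Set (Fin n))) : (ask b X k).val M = (k false).val M := by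
  simp [val, h]

theorem cost_ask_of_indep {b : Bool} {X : Finset (Fin n)} (k : Bool → QTree n α)
    (h : (M b).Indep (X : Set (Fin n))) : (ask b X k).cost M = (k true).cost M + 1 := by
  simp [cost, h]

theorem cost_ask_of_not_indep {b : Bool} {X : Finset (Fin n)} (k : Bool → QTree n α)
    (h : ¬ (M b).Indep (X : Set (Fin n))) : (ask b X k).cost M = (k false).cost M + 1 := by
  simp [cost, h]

@[simp] theorem val_bind (t : QTree n α) (f : α → QTree n β) :
    (t.bind f).val M = (f (t.val M)).val M := by
  induction t with
  | ret a => rfl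
  | ask b X k ih => exact ih _

@[simp] theorem cost_bind (t : QTree n α) (f : α → QTree n β) :
    (t.bind f).cost M = t.cost M + (f (t.val M)).cost M := by
  induction t with
  | ret a => simp [bind]
  | ask b X k ih => simp only [bind, cost, val, ih]; omega

/-- The invariant rule for folds: `P pre s c` speaks of the processed prefix `pre`, the current
state `s`, and the number `c` of queries so far. -/
theorem fold_induction (f : σ → β → QTree n σ) (P : List β → σ → ℕ → Prop) (L : List β) (s : σ)
    (h0 : P [] s 0)
    (hstep : ∀ pre b post s c, L = pre ++ b :: post → P pre s c →
      P (pre ++ [b]) ((f s b).val M) (c + (f s b).cost M)) :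
    P L ((fold f s L).val M) ((fold f s L).cost M) := by
  suffices h : ∀ post pre s c, L = pre ++ post → P pre s c →
      P L ((fold f s post).val M) (c + (fold f s post).cost M) by
    simpa using h L [] s 0 rfl h0
  intro post
  induction post with
  | nil => intro pre s c hL hP; simpa [fold, hL] using hP
  | cons b post ih =>
    intro pre s c hL hP
    have := ih (pre ++ [b]) _ _ (by simp [hL]) (hstep pre b post s c hL hP)
    simpa [fold, add_assoc] using this

end QTree

/-! ### Span and rank in matroids on a finite ground set. -/

section MatroidFacts

variable {n : ℕ} {M : Matroid (Fin n)}

theorem mem_closure_of_not_indep_insert (hE : M.E = Set.univ) {I : Finset (Fin n)} {e : Fin n}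
    (hI : M.Indep (I : Set (Fin n))) (h : ¬ M.Indep ((insert e I : Finset (Fin n)) : Set (Fin n))) :
    e ∈ M.closure (I : Set (Fin n)) := by
  by_contra hc
  apply h
  rw [Finset.coe_insert, hI.insert_indep_iff]
  left
  exact ⟨by simp [hE], hc⟩

theorem mem_closure_of_mem (hE : M.E = Set.univ) {I : Finset (Fin n)} {e : Fin n} (h : e ∈ I) :
    e ∈ M.closure (I : Set (Fin n)) :=
  M.mem_closure_of_mem' (by simpa using h) (by simp [hE])

theorem mem_closure_mono {I J : Finset (Fin n)} {e : Fin n}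
    (h : e ∈ M.closure (I : Set (Fin n))) (hIJ : I ⊆ J) : e ∈ M.closure (J : Set (Fin n)) :=
  M.closure_subset_closure (by exact_mod_cast hIJ) h

theorem mem_closure_trans {I J : Finset (Fin n)} {e : Fin n}
    (h : e ∈ M.closure (I : Set (Fin n))) (hIJ : ∀ x ∈ I, x ∈ M.closure (J : Set (Fin n))) :
    e ∈ M.closure (J : Set (Fin n)) :=
  M.closure_subset_closure_of_subset_closure (fun x hx => hIJ x (by simpa using hx)) h

/-- The rank of a finite set of elements, as a natural number. -/
noncomputable def frk (M : Matroid (Fin n)) (X : Finset (Fin n)) : ℕ :=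
  (M.eRk (X : Set (Fin n))).toNat

theorem card_le_card_of_span {I Y : Finset (Fin n)} (hI : M.Indep (I : Set (Fin n)))
    (h : ∀ x ∈ I, x ∈ M.closure (Y : Set (Fin n))) : I.card ≤ Y.card := by
  have h1 : M.eRk (I : Set (Fin n)) ≤ M.eRk (Y : Set (Fin n)) := by
    rw [← M.eRk_closure_eq (Y : Set (Fin n))]
    exact M.eRk_mono fun x hx => h x (by simpa using hx)
  rw [hI.eRk_eq_encard] at h1
  have h2 := h1.trans (M.eRk_le_encard (Y : Set (Fin n)))
  simpa [Set.encard_coe_eq_coe_finsetCard] using h2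

theorem exists_basis_frk (hE : M.E = Set.univ) (X : Finset (Fin n)) :
    ∃ B ⊆ X, M.Indep (B : Set (Fin n)) ∧ (∀ x ∈ X, x ∈ M.closure (B : Set (Fin n))) ∧
      B.card = frk M X := by
  classical
  obtain ⟨B, hB⟩ := M.exists_isBasis (X : Set (Fin n)) (by simp [hE])
  have hfin : B.Finite := Set.toFinite B
  refine ⟨hfin.toFinset, ?_, ?_, ?_, ?_⟩
  · intro x hx
    exact hB.subset (by simpa using hx)
  · simpa using hB.indep
  · intro x hx
    simpa using hB.subset_closure (show x ∈ (X : Set (Fin n)) from hx)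
  · unfold frk
    rw [← hB.encard_eq_eRk, hfin.encard_eq_coe_toFinset_card]
    simp

theorem frk_le_card_of_span (hE : M.E = Set.univ) {X Y : Finset (Fin n)}
    (h : ∀ x ∈ X, x ∈ M.closure (Y : Set (Fin n))) : frk M X ≤ Y.card := by
  obtain ⟨B, hBX, hB, -, hc⟩ := exists_basis_frk hE X
  rw [← hc]
  exact card_le_card_of_span hB fun x hx => h x (hBX hx)

theorem card_le_frk (hE : M.E = Set.univ) {X I : Finset (Fin n)} (hI : M.Indep (I : Set (Fin n)))
    (h : I ⊆ X) : I.card ≤ frk M X := by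
  obtain ⟨B, -, -, hs, hc⟩ := exists_basis_frk hE X
  rw [← hc]
  exact card_le_card_of_span hI fun x hx => hs x (h hx)

theorem frk_empty (hE : M.E = Set.univ) : frk M (∅ : Finset (Fin n)) = 0 := by
  have := frk_le_card_of_span (M := M) hE (X := ∅) (Y := ∅) (by simp)
  simpa using this

/-- An independent set stays independent when a part of it is replaced by an independent set that
the part spans. -/
theorem indep_union_of_span {B Y Z : Finset (Fin n)}
    (hBZ : M.Indep ((B ∪ Z : Finset _) : Set (Fin n)))
    (hd : Disjoint B Z) (hY : M.Indep (Y : Set (Fin n)))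
    (hYB : ∀ y ∈ Y, y ∈ M.closure (B : Set (Fin n))) :
    M.Indep ((Y ∪ Z : Finset _) : Set (Fin n)) := by
  have hZ : M.Indep (Z : Set (Fin n)) := hBZ.subset (by simp)
  rw [Finset.coe_union, hY.union_indep_iff_forall_notMem_closure_right hZ]
  rintro e ⟨heZ, heY⟩ hc
  refine hBZ.notMem_closure_sdiff_of_mem (e := e) (by simp; right; simpa using heZ) ?_
  refine M.closure_subset_closure_of_subset_closure ?_ hc
  have hE := hBZ.subset_ground
  rintro x (hx | hx)
  · refine M.closure_subset_closure ?_ (hYB x (by simpa using hx))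
    intro y hy
    refine ⟨by simp; left; simpa using hy, ?_⟩
    rintro rfl
    exact Finset.disjoint_left.1 hd (by simpa using hy) (by simpa using heZ)
  · refine M.mem_closure_of_mem' ⟨by simp; right; simpa using hx.1, hx.2⟩ (hE ?_)
    simp; right; simpa using hx.1

/-- Two spanning sets inside a common independent set: so is their intersection. -/
theorem mem_closure_inter {I J K : Finset (Fin n)} {e : Fin n} (hI : M.Indep (I : Set (Fin n)))
    (hJ : J ⊆ I) (hK : K ⊆ I) (h1 : e ∈ M.closure (J : Set (Fin n)))
    (h2 : e ∈ M.closure (K : Set (Fin n))) : e ∈ M.closure ((J ∩ K : Finset _) : Set (Fin n)) := by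
  rw [Finset.coe_inter, Matroid.Indep.closure_inter_eq_inter_closure]
  · exact ⟨h1, h2⟩
  · refine hI.subset ?_
    have := Finset.union_subset hJ hK
    exact_mod_cast this

/-- The easy half of matroid intersection duality, for a covering of the ground set. -/
theorem card_le_of_cover {M₁ M₂ : Matroid (Fin n)} (hE₁ : M₁.E = Set.univ) {I P Q : Finset (Fin n)}
    (h1 : M₁.Indep (I : Set (Fin n))) (h2 : M₂.Indep (I : Set (Fin n)))
    (hc : ∀ e, e ∈ P ∨ e ∈ M₂.closure (Q : Set (Fin n))) : I.card ≤ frk M₁ P + Q.card := by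
  classical
  rw [← Finset.card_filter_add_card_filter_not (s := I) (· ∈ P)]
  refine add_le_add ?_ ?_
  · exact card_le_frk hE₁ (h1.subset (Finset.coe_subset.2 (Finset.filter_subset _ _)))
      (fun x hx => (Finset.mem_filter.1 hx).2)
  · refine card_le_card_of_span (h2.subset (Finset.coe_subset.2
      (Finset.filter_subset (fun x => ¬ x ∈ P) I))) fun x hx => ?_
    have := hc x
    have h' := (Finset.mem_filter.1 hx).2
    tauto

end MatroidFacts

/-! ### Greedy bases of a sorted list. -/

namespace QTree

variable {n : ℕ}

/-- Go through a list and keep each element that preserves independence in the matroid `b`. -/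
def greedy (b : Bool) (L : List (Fin n)) : QTree n (Finset (Fin n)) :=
  fold (fun I e => ask b (insert e I) fun a => ret (if a then insert e I else I)) ∅ L

/-- An element is discarded only if the elements kept so far span it, and these precede it in the
list. For a list sorted by level, the result therefore contains a basis of every initial range of
levels simultaneously. -/
theorem greedy_spec (M : Bool → Matroid (Fin n)) (hE : ∀ b, (M b).E = Set.univ) (b : Bool)
    (L : List (Fin n)) (r : Fin n → Fin n → Prop) [DecidableRel r] (hr : ∀ x, r x x)
    (hL : L.Pairwise r) :
    (∀ x ∈ (greedy b L).val M, x ∈ L) ∧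
    (M b).Indep (((greedy b L).val M : Finset (Fin n)) : Set (Fin n)) ∧
    (∀ x ∈ L, x ∈ (M b).closure
      ((((greedy b L).val M).filter (fun y => r y x) : Finset _) : Set (Fin n))) ∧
    (greedy b L).cost M = L.length := by
  refine fold_induction M _ (fun pre (I : Finset (Fin n)) c => (∀ x ∈ I, x ∈ pre) ∧
    (M b).Indep (I : Set (Fin n)) ∧ (∀ x ∈ pre, x ∈ (M b).closure ((I.filter (fun y => r y x) : Finset _) : Set (Fin n))) ∧
    c = pre.length) L ∅ ?_ ?_
  · simp
  rintro pre e post I c rfl ⟨h1, h2, h3, h4⟩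
  have hpre : ∀ y ∈ pre, r y e := by
    intro y hy
    rw [List.pairwise_append] at hL
    exact hL.2.2 y hy e (by simp)
  by_cases h : (M b).Indep ((insert e I : Finset (Fin n)) : Set (Fin n))
  · rw [val_ask_of_indep _ _ h, cost_ask_of_indep _ _ h]
    simp only [if_true, val_ret, cost_ret]
    refine ⟨?_, h, ?_, by simp [h4]⟩
    · intro x hx
      rcases Finset.mem_insert.1 hx with rfl | hx
      · simp
      · simp [h1 x hx]
    · intro x hx
      rw [List.mem_append] at hx
      rcases hx with hx | hx
      · exact mem_closure_mono (h3 x hx) (Finset.filter_subset_filter _ (Finset.subset_insert _ _))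
      · rw [List.mem_singleton] at hx
        subst hx
        exact mem_closure_of_mem (hE b) (by simp [hr])
  · rw [val_ask_of_not_indep _ _ h, cost_ask_of_not_indep _ _ h]
    simp only [val_ret, cost_ret]
    refine ⟨?_, h2, ?_, by simp [h4]⟩
    · intro x hx
      simp only [Bool.false_eq_true, if_false] at hx
      simp [h1 x hx]
    · intro x hx
      simp only [Bool.false_eq_true, if_false]
      rw [List.mem_append] at hx
      rcases hx with hx | hx
      · exact h3 x hx
      · rw [List.mem_singleton] at hx
        subst hx
        refine mem_closure_mono (mem_closure_of_not_indep_insert (hE b) h2 h) ?_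
        intro y hy
        simp [hy, hpre y (h1 y hy)]

end QTree

/-! ### The auction: its invariant, near-optimality, and the selection of elements. -/

namespace Auction

open QTree

variable {n : ℕ}

/-- The elements of level less than `t`. -/
def lower (l : Fin n → ℕ) (t : ℕ) : Finset (Fin n) := Finset.univ.filter fun x => l x < t

/-- The elements of `S` of level `t`. -/
def level (l : Fin n → ℕ) (S : Finset (Fin n)) (t : ℕ) : Finset (Fin n) := S.filter fun x => l x = t

/-- The elements of `S` of level at least `t`. -/
def upper (l : Fin n → ℕ) (S : Finset (Fin n)) (t : ℕ) : Finset (Fin n) := S.filter fun x => t ≤ l x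

/-- `Z` extends every independent subset of `X`. For disjoint `X` and `Z`, this is independence
of `Z` in the contraction by `X`. -/
def Over (M : Matroid (Fin n)) (X Z : Finset (Fin n)) : Prop :=
  ∀ Y ⊆ X, M.Indep (Y : Set (Fin n)) → M.Indep ((Y ∪ Z : Finset _) : Set (Fin n))

/-- The invariant of the auction with the levels `0, …, k - 1`: `S` holds elements of these levels,
is independent in the second matroid, each of its levels is independent over the lower levels in
the first matroid, and everything above a level is spanned in the second matroid by the elements of
`S` from that level on. -/
structure Inv (M : Bool → Matroid (Fin n)) (k : ℕ) (S : Finset (Fin n)) (l : Fin n → ℕ) : Prop where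
  lt : ∀ e ∈ S, l e < k
  indep : (M true).Indep (S : Set (Fin n))
  skew : ∀ t < k, Over (M false) (lower l t) (level l S t)
  dom : ∀ t < k, ∀ e, t < l e → e ∈ (M true).closure (upper l S t : Set (Fin n))

theorem mem_lower {l : Fin n → ℕ} {t : ℕ} {e : Fin n} : e ∈ lower l t ↔ l e < t := by simp [lower]

theorem mem_level {l : Fin n → ℕ} {S : Finset (Fin n)} {t : ℕ} {e : Fin n} :
    e ∈ level l S t ↔ e ∈ S ∧ l e = t := by simp [level]

theorem mem_upper {l : Fin n → ℕ} {S : Finset (Fin n)} {t : ℕ} {e : Fin n} :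
    e ∈ upper l S t ↔ e ∈ S ∧ t ≤ l e := by simp [upper]

theorem lower_succ (l : Fin n → ℕ) (t : ℕ) : lower l t ⊆ lower l (t + 1) := fun e he => by
  rw [mem_lower] at *; omega

theorem Over.card_add_frk_le {M : Matroid (Fin n)} (hE : M.E = Set.univ) {X Z W : Finset (Fin n)}
    (h : Over M X Z) (hd : Disjoint X Z) (hX : X ⊆ W) (hZ : Z ⊆ W) :
    frk M X + Z.card ≤ frk M W := by
  obtain ⟨B, hBX, hB, -, hc⟩ := exists_basis_frk hE X
  rw [← hc, ← Finset.card_union_of_disjoint (hd.mono_left hBX)]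
  exact card_le_frk hE (h B hBX hB) (Finset.union_subset (hBX.trans hX) hZ)

section Inv

variable {M : Bool → Matroid (Fin n)} {k : ℕ} {S : Finset (Fin n)} {l : Fin n → ℕ}

theorem disjoint_lower_level (l : Fin n → ℕ) (S : Finset (Fin n)) (t : ℕ) :
    Disjoint (lower l t) (level l S t) := by
  rw [Finset.disjoint_left]
  intro e h1 h2
  rw [mem_lower] at h1
  rw [mem_level] at h2
  omega

theorem Inv.frk_add_card_level_le (h : Inv M k S l) (hE : ∀ b, (M b).E = Set.univ) {t : ℕ}
    (ht : t < k) :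
    frk (M false) (lower l t) + (level l S t).card ≤ frk (M false) (lower l (t + 1)) := by
  refine (h.skew t ht).card_add_frk_le (hE false) (disjoint_lower_level l S t) (lower_succ l t) ?_
  intro e he
  rw [mem_level] at he
  rw [mem_lower]
  omega

theorem card_upper_eq (l : Fin n → ℕ) (S : Finset (Fin n)) (t : ℕ) :
    (upper l S t).card = (level l S t).card + (upper l S (t + 1)).card := by
  rw [← Finset.card_union_of_disjoint]
  · congr 1
    ext e
    simp only [Finset.mem_union, mem_upper, mem_level]
    constructor
    · rintro ⟨h, h'⟩
      rcases h'.eq_or_lt with h' | h'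
      · exact Or.inl ⟨h, h'.symm⟩
      · exact Or.inr ⟨h, h'⟩
    · rintro (⟨h, h'⟩ | ⟨h, h'⟩)
      · exact ⟨h, h'.ge⟩
      · exact ⟨h, by omega⟩
  · rw [Finset.disjoint_left]
    intro e h1 h2
    rw [mem_level] at h1
    rw [mem_upper] at h2
    omega

theorem Inv.upper_top (h : Inv M k S l) : upper l S k = ∅ := by
  ext e
  simp only [mem_upper, Finset.notMem_empty, iff_false, not_and, not_le]
  exact h.lt e

theorem sum_card_level (l : Fin n → ℕ) (S : Finset (Fin n)) (k : ℕ) (h : ∀ e ∈ S, l e < k) :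
    ∑ t ∈ Finset.range k, (level l S t).card = S.card :=
  (Finset.card_eq_sum_card_fiberwise fun e he => by simpa using h e he).symm

/-- Passing level `t` raises the rank in the first matroid by at least the size of that level of
`S`; these gains add up from `t` to `k`. -/
theorem Inv.frk_add_card_upper_le (h : Inv M k S l) (hE : ∀ b, (M b).E = Set.univ) {t : ℕ}
    (ht : t ≤ k) :
    frk (M false) (lower l t) + (upper l S t).card ≤ frk (M false) (lower l k) := by
  induction ht using Nat.decreasingInduction with
  | self => simp [h.upper_top]
  | of_succ t ht ih =>
    have := h.frk_add_card_level_le hE ht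
    rw [card_upper_eq]
    omega

/-- Assemble `S` from the bottom: each level extends any independent set of lower elements, in
particular the part of `S` already assembled. -/
theorem Inv.indep_false (h : Inv M k S l) : (M false).Indep (S : Set (Fin n)) := by
  have key : ∀ t ≤ k, (M false).Indep ((S.filter fun x => l x < t : Finset _) : Set (Fin n)) := by
    intro t
    induction t with
    | zero => simp
    | succ t ih =>
      intro ht
      have := h.skew t (by omega) (S.filter fun x => l x < t) (fun e he => by
        rw [mem_lower]; exact (Finset.mem_filter.1 he).2) (ih (by omega))
      refine this.subset ?_
      rw [Finset.coe_subset]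
      intro e he
      rw [Finset.mem_filter] at he
      rw [Finset.mem_union, Finset.mem_filter, mem_level]
      have : l e < t ∨ l e = t := by omega
      tauto
  refine (key k le_rfl).subset ?_
  rw [Finset.coe_subset]
  intro e he
  exact Finset.mem_filter.2 ⟨he, h.lt e he⟩

/-- A state of the auction is nearly optimal when the first matroid wants few further elements. -/
theorem Inv.mul_card_le (h : Inv M k S l) (hE : ∀ b, (M b).E = Set.univ) {I : Finset (Fin n)}
    (h1 : (M false).Indep (I : Set (Fin n))) (h2 : (M true).Indep (I : Set (Fin n))) :
    k * I.card ≤ k * frk (M false) (lower l k) + S.card := by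
  have key : ∀ t ∈ Finset.range k,
      I.card ≤ frk (M false) (lower l k) + (level l S t).card := by
    intro t ht
    rw [Finset.mem_range] at ht
    -- One covering per threshold `t`. The levels of `S` above `t` cancel against the rank that they
    -- force below level `k`, so only level `t` remains as error; these errors sum to `S.card`.
    have hc := card_le_of_cover (hE false) h1 h2 (P := lower l (t + 1))
      (Q := upper l S t) fun e => by
        by_cases he : l e < t + 1
        · exact Or.inl (mem_lower.2 he)
        · exact Or.inr (h.dom t ht e (by omega))
    have := h.frk_add_card_upper_le hE (t := t + 1) ht
    rw [card_upper_eq] at hc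
    omega
  have := Finset.sum_le_sum key
  simpa [Finset.sum_add_distrib, sum_card_level l S k h.lt] using this

end Inv

/-- The set against which the first matroid tests an element of level `t`. -/
def supply (l : Fin n → ℕ) (B S T : Finset (Fin n)) (t : ℕ) : Finset (Fin n) :=
  B.filter (fun x => l x < t) ∪ level l (S ∪ T) t

/-- The set against which the second matroid tests an element of level `t`. -/
def demand (l : Fin n → ℕ) (S T : Finset (Fin n)) (t : ℕ) : Finset (Fin n) :=
  upper l S t ∪ level l T t

theorem supply_insert (l : Fin n → ℕ) (B S T : Finset (Fin n)) (t : ℕ) (e : Fin n) :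
    supply l B S (insert e T) t = if l e = t then insert e (supply l B S T t)
      else supply l B S T t := by
  ext x
  split_ifs with h <;>
  simp only [supply, level, Finset.mem_union, Finset.mem_filter, Finset.mem_insert]
  · by_cases hx : x = e
    · subst hx; simp [h]
    · simp [hx]
  · by_cases hx : x = e
    · subst hx; simp [h]
    · simp [hx]

theorem demand_insert (l : Fin n → ℕ) (S T : Finset (Fin n)) (t : ℕ) (e : Fin n) :
    demand l S (insert e T) t = if l e = t then insert e (demand l S T t)
      else demand l S T t := by
  ext x
  split_ifs with h <;>
  simp only [demand, level, Finset.mem_union, Finset.mem_filter, Finset.mem_insert]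
  · by_cases hx : x = e
    · subst hx; simp [h]
    · simp [hx]
  · by_cases hx : x = e
    · subst hx; simp [h]
    · simp [hx]

/-- The first matroid proposes elements outside `S`; the second one accepts some of them (first
component of the result) and rejects others (second component). -/
noncomputable def select (k : ℕ) (S : Finset (Fin n)) (l : Fin n → ℕ) (B : Finset (Fin n)) :
    QTree n (Finset (Fin n) × Finset (Fin n)) :=
  fold (fun TR e =>
    if e ∈ S ∨ k ≤ l e then ret TR
    else ask false (insert e (supply l B S TR.1 (l e))) fun a =>
      if a then ask true (insert e (demand l S TR.1 (l e))) fun a' =>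
        ret (if a' then (insert e TR.1, TR.2) else (TR.1, insert e TR.2))
      else ret TR) (∅, ∅) Finset.univ.toList

/-- What is known about the accepted set `T` and the rejected set `R` once the elements of `P`
have been considered. -/
structure Selection (M : Bool → Matroid (Fin n)) (k : ℕ) (S : Finset (Fin n)) (l : Fin n → ℕ)
    (B : Finset (Fin n)) (P : Fin n → Prop) (T R : Finset (Fin n)) : Prop where
  mem : ∀ e, e ∈ T ∨ e ∈ R → P e ∧ e ∉ S ∧ l e < k
  disj : ∀ e, e ∈ T → e ∉ R
  supply_indep : ∀ t < k, (M false).Indep (supply l B S T t : Set (Fin n))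
  demand_indep : ∀ t < k, (M true).Indep (demand l S T t : Set (Fin n))
  rest : ∀ e, P e → l e < k → e ∉ R →
    e ∈ (M false).closure (supply l B S T (l e) : Set (Fin n))
  rej : ∀ e ∈ R, e ∈ (M true).closure (demand l S T (l e) : Set (Fin n))

theorem Selection.empty {M : Bool → Matroid (Fin n)} {k : ℕ}
    {S : Finset (Fin n)} {l : Fin n → ℕ} (h : Inv M k S l) {B : Finset (Fin n)}
    (hB : (M false).Indep (B : Set (Fin n))) :
    Selection M k S l B (fun _ => False) ∅ ∅ where
  mem := by simp
  disj := by simp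
  supply_indep t ht := by
    have := h.skew t ht (B.filter fun x => l x < t)
      (fun e he => mem_lower.2 (Finset.mem_filter.1 he).2)
      (hB.subset (Finset.coe_subset.2 (Finset.filter_subset _ _)))
    simpa [supply] using this
  demand_indep t ht := by
    have : demand l S ∅ t ⊆ S := fun e he => by
      simp only [demand, level, Finset.filter_empty, Finset.union_empty, mem_upper] at he
      exact he.1
    exact h.indep.subset (Finset.coe_subset.2 this)
  rest := by simp
  rej := by simp

/-- `supply` and `demand` only grow with `T`, so an element refused by either matroid remains
spanned to the end. An element that the first matroid does not want enters neither `T` nor `R` and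
keeps its level. -/
theorem select_spec {M : Bool → Matroid (Fin n)} (hE : ∀ b, (M b).E = Set.univ) {k : ℕ}
    {S : Finset (Fin n)} {l : Fin n → ℕ} (h : Inv M k S l) {B : Finset (Fin n)}
    (hB : (M false).Indep (B : Set (Fin n))) :
    Selection M k S l B (fun _ => True) ((select k S l B).val M).1 ((select k S l B).val M).2 ∧
      (select k S l B).cost M ≤ 2 * n := by
  have key := fold_induction M (fun TR e =>
    if e ∈ S ∨ k ≤ l e then ret TR
    else ask false (insert e (supply l B S TR.1 (l e))) fun a =>
      if a then ask true (insert e (demand l S TR.1 (l e))) fun a' =>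
        ret (if a' then (insert e TR.1, TR.2) else (TR.1, insert e TR.2))
      else ret TR) (fun pre (TR : Finset (Fin n) × Finset (Fin n)) c =>
        Selection M k S l B (· ∈ pre) TR.1 TR.2 ∧ c ≤ 2 * pre.length)
      (Finset.univ : Finset (Fin n)).toList (∅, ∅) ?_ ?_
  · refine ⟨?_, ?_⟩
    · have := key.1
      simp only [Finset.mem_toList, Finset.mem_univ] at this
      exact this
    · have := key.2
      rwa [Finset.length_toList, Finset.card_univ, Fintype.card_fin] at this
  · exact ⟨by simpa using Selection.empty h hB, by simp⟩
  rintro pre e post ⟨T, R⟩ c hL ⟨hs, hc⟩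
  have hepre : e ∉ pre := by
    have hnd := (Finset.univ : Finset (Fin n)).nodup_toList
    rw [hL, List.nodup_append] at hnd
    intro he
    exact hnd.2.2 e he e (by simp) rfl
  have hmemP : ∀ x, x ∈ pre ++ [e] ↔ x ∈ pre ∨ x = e := by simp
  have hlen : (pre ++ [e]).length = pre.length + 1 := by simp
  have old : ∀ T' R', Selection M k S l B (· ∈ pre) T' R' →
      (l e < k → e ∉ R' → e ∈ (M false).closure (supply l B S T' (l e) : Set (Fin n))) →
      Selection M k S l B (· ∈ pre ++ [e]) T' R' := by
    intro T' R' hs' he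
    exact { hs' with
      mem := fun x hx => ⟨(hmemP x).2 (Or.inl (hs'.mem x hx).1), (hs'.mem x hx).2⟩
      rest := fun x hx hxk hxR => by
        rcases (hmemP x).1 hx with hx | rfl
        · exact hs'.rest x hx hxk hxR
        · exact he hxk hxR }
  simp only
  split_ifs with h0
  · refine ⟨old T R hs fun hk _ => ?_, by simp; omega⟩
    refine mem_closure_of_mem (hE false) ?_
    rcases h0 with h0 | h0
    · simp [supply, level, h0]
    · omega
  push Not at h0
  obtain ⟨heS, hek⟩ := h0
  have heT : e ∉ T := fun he => hepre (hs.mem e (Or.inl he)).1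
  have heR : e ∉ R := fun he => hepre (hs.mem e (Or.inr he)).1
  by_cases h1 : (M false).Indep ((insert e (supply l B S T (l e)) : Finset _) : Set (Fin n))
  swap
  · rw [val_ask_of_not_indep _ _ h1, cost_ask_of_not_indep _ _ h1]
    refine ⟨old T R hs fun _ _ => ?_, by simp; omega⟩
    exact mem_closure_of_not_indep_insert (hE false) (hs.supply_indep _ hek) h1
  rw [val_ask_of_indep _ _ h1, cost_ask_of_indep _ _ h1]
  simp only [if_true]
  by_cases h2 : (M true).Indep ((insert e (demand l S T (l e)) : Finset _) : Set (Fin n))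
  · rw [val_ask_of_indep _ _ h2, cost_ask_of_indep _ _ h2]
    have hsup : ∀ t, supply l B S T t ⊆ supply l B S (insert e T) t := by
      intro t
      rw [supply_insert]
      split_ifs
      · exact Finset.subset_insert _ _
      · exact subset_rfl
    have hdem : ∀ t, demand l S T t ⊆ demand l S (insert e T) t := by
      intro t
      rw [demand_insert]
      split_ifs
      · exact Finset.subset_insert _ _
      · exact subset_rfl
    refine ⟨?_, by simp; omega⟩
    simp only [if_true, val_ret]
    constructor
    · intro x hx
      rw [Finset.mem_insert] at hx
      rw [hmemP]
      rcases hx with (rfl | hx) | hx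
      · exact ⟨Or.inr rfl, heS, hek⟩
      · have := hs.mem x (Or.inl hx); tauto
      · have := hs.mem x (Or.inr hx); tauto
    · intro x hx hxR
      rcases Finset.mem_insert.1 hx with rfl | hx
      · exact heR hxR
      · exact hs.disj x hx hxR
    · intro t ht
      rw [supply_insert]
      split_ifs with hte
      · subst hte; exact h1
      · exact hs.supply_indep t ht
    · intro t ht
      rw [demand_insert]
      split_ifs with hte
      · subst hte; exact h2
      · exact hs.demand_indep t ht
    · intro x hx hxk hxR
      rcases (hmemP x).1 hx with hx | rfl
      · exact mem_closure_mono (hs.rest x hx hxk hxR) (hsup _)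
      · refine mem_closure_of_mem (hE false) ?_
        rw [supply_insert, if_pos rfl]
        exact Finset.mem_insert_self _ _
    · intro x hx
      exact mem_closure_mono (hs.rej x hx) (hdem _)
  · rw [val_ask_of_not_indep _ _ h2, cost_ask_of_not_indep _ _ h2]
    refine ⟨?_, by simp; omega⟩
    simp only [Bool.false_eq_true, if_false, val_ret]
    exact
      { mem := fun x hx => by
          rw [Finset.mem_insert] at hx
          rw [hmemP]
          rcases hx with hx | rfl | hx
          · have := hs.mem x (Or.inl hx); tauto
          · exact ⟨Or.inr rfl, heS, hek⟩
          · have := hs.mem x (Or.inr hx); tauto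
        disj := fun x hx hxR => by
          rcases Finset.mem_insert.1 hxR with rfl | hxR
          · exact heT hx
          · exact hs.disj x hx hxR
        supply_indep := hs.supply_indep
        demand_indep := hs.demand_indep
        rest := fun x hx hxk hxR => by
          rw [Finset.mem_insert, not_or] at hxR
          rcases (hmemP x).1 hx with hx | rfl
          · exact hs.rest x hx hxk hxR.2
          · exact absurd rfl hxR.1
        rej := fun x hx => by
          rcases Finset.mem_insert.1 hx with rfl | hx
          · exact mem_closure_of_not_indep_insert (hE true) (hs.demand_indep _ hek) h2
          · exact hs.rej x hx }

end Auction

/-! ### Rounds of the auction and the potential argument. -/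

namespace Auction

open QTree

variable {n : ℕ}

/-- One round of the auction with `k` levels. -/
noncomputable def round (k : ℕ) (s : Finset (Fin n) × (Fin n → ℕ)) :
    QTree n (Finset (Fin n) × (Fin n → ℕ)) :=
  (greedy false (Finset.univ.toList.insertionSort fun x y => s.2 x ≤ s.2 y)).bind fun B =>
  (select k s.1 s.2 B).bind fun TR =>
  (greedy true ((s.1 ∪ TR.1).toList.insertionSort fun x y => s.2 y ≤ s.2 x)).bind fun S' =>
  ret (S', fun e => if e ∈ TR.2 ∨ (e ∈ s.1 ∪ TR.1 ∧ e ∉ S') then s.2 e + 1 else s.2 e)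

/-- The potential of a state of the auction; the ranks are capped at `c`. -/
noncomputable def potential (M : Matroid (Fin n)) (k c : ℕ)
    (s : Finset (Fin n) × (Fin n → ℕ)) : ℤ :=
  ∑ t ∈ Finset.range k, (((upper s.2 s.1 t).card : ℤ) - (min (frk M (lower s.2 (t + 1))) c : ℕ))

/-- Accepted elements add the same amount to the lower bound for `upper` and to the upper bound for
the new ranks, so they cancel in the potential. What remains is an index shift of the ranks by one
level, worth the capped rank below `k`, minus `S.card`. -/
theorem round_spec {M : Bool → Matroid (Fin n)} (hE : ∀ b, (M b).E = Set.univ) {k : ℕ}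
    {s : Finset (Fin n) × (Fin n → ℕ)} (h : Inv M k s.1 s.2) (c : ℕ) :
    Inv M k ((round k s).val M).1 ((round k s).val M).2 ∧ (round k s).cost M ≤ 4 * n ∧
    potential (M false) k c s + (min (frk (M false) (lower s.2 k)) c : ℕ) - s.1.card ≤
      potential (M false) k c ((round k s).val M) := by
  obtain ⟨S, l⟩ := s
  simp only at h ⊢
  simp only [round, val_bind, cost_bind, val_ret, cost_ret]
  have hg1 := greedy_spec M hE false (Finset.univ.toList.insertionSort fun x y => l x ≤ l y)
    (fun x y => l x ≤ l y) (fun _ => le_rfl)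
    (@List.pairwise_insertionSort _ (fun x y => l x ≤ l y) _ ⟨fun x y => le_total _ _⟩
      ⟨fun _ _ _ h h' => h.trans h'⟩ _)
  generalize (greedy false _).val M = B at hg1 ⊢
  obtain ⟨-, hB, hBs, hBc⟩ := hg1
  obtain ⟨hsel, hselc⟩ := select_spec hE h hB
  generalize (select k S l B).val M = TR at hsel ⊢
  obtain ⟨T, R⟩ := TR
  simp only at hsel ⊢
  have hg2 := greedy_spec M hE true ((S ∪ T).toList.insertionSort fun x y => l y ≤ l x)
    (fun x y => l y ≤ l x) (fun _ => le_rfl)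
    (@List.pairwise_insertionSort _ (fun x y => l y ≤ l x) _ ⟨fun x y => le_total _ _⟩
      ⟨fun _ _ _ h h' => h'.trans h⟩ _)
  generalize (greedy true _).val M = S' at hg2 ⊢
  obtain ⟨hSA, hS, hSs, hSc⟩ := hg2
  simp only [List.mem_insertionSort, Finset.mem_toList, List.length_insertionSort,
    Finset.length_toList, Finset.mem_univ, true_implies, Finset.card_univ, Fintype.card_fin]
    at hBs hBc hSA hSs hSc
  set l' : Fin n → ℕ := fun e => if e ∈ R ∨ (e ∈ S ∪ T ∧ e ∉ S') then l e + 1 else l e with hl'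
  have hle : ∀ e, l e ≤ l' e := fun e => by simp only [hl']; split_ifs <;> omega
  have hle' : ∀ e, l' e ≤ l e + 1 := fun e => by simp only [hl']; split_ifs <;> omega
  have hltA : ∀ e ∈ S ∪ T, l e < k := by
    intro e he
    rcases Finset.mem_union.1 he with he | he
    · exact h.lt e he
    · exact (hsel.mem e (Or.inl he)).2.2
  have hRA : ∀ e ∈ R, e ∉ S ∪ T := by
    intro e he hA
    rcases Finset.mem_union.1 hA with hA | hA
    · exact (hsel.mem e (Or.inr he)).2.1 hA
    · exact hsel.disj e hA he
  have hl'S : ∀ e ∈ S', l' e = l e := by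
    intro e he
    simp only [hl']
    rw [if_neg]
    rintro (h | h)
    · exact hRA e h (hSA e he)
    · exact h.2 he
  -- As `S'` is chosen greedily from high levels to low ones, dropping elements loses no span above
  -- any threshold.
  have hup : ∀ t, ∀ e ∈ upper l (S ∪ T) t, e ∈ (M true).closure (upper l' S' t : Set (Fin n)) := by
    intro t e he
    rw [mem_upper] at he
    refine mem_closure_mono (hSs e he.1) fun x hx => ?_
    rw [Finset.mem_filter] at hx
    rw [mem_upper, hl'S x hx.1]
    exact ⟨hx.1, he.2.trans hx.2⟩
  have hdemA : ∀ t, demand l S T t ⊆ upper l (S ∪ T) t := by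
    intro t e he
    simp only [demand, Finset.mem_union, mem_upper, mem_level] at he ⊢
    rcases he with he | he
    · exact ⟨Or.inl he.1, he.2⟩
    · exact ⟨Or.inr he.1, he.2.ge⟩
  have hST : Disjoint S T := by
    rw [Finset.disjoint_left]
    intro e h1 h2
    exact (hsel.mem e (Or.inl h2)).2.1 h1
  refine ⟨⟨?_, hS, ?_, ?_⟩, ?_, ?_⟩
  · intro e he
    rw [hl'S e he]
    exact hltA e (hSA e he)
  -- Levels only rise, so `Y` was already below `t` and is spanned by the part of `B` below `t`.
  -- That part can be replaced by `Y` in the independent set `supply l B S T t`.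
  · intro t ht Y hY hYi
    have hYs : ∀ y ∈ Y, y ∈ (M false).closure ((B.filter fun x => l x < t : Finset _) : Set _) := by
      intro y hy
      refine mem_closure_mono (hBs y) fun x hx => ?_
      have := mem_lower.1 (hY hy)
      have := hle y
      rw [Finset.mem_filter] at hx ⊢
      exact ⟨hx.1, by omega⟩
    have := indep_union_of_span (hsel.supply_indep t ht) ?_ hYi hYs
    · refine this.subset (Finset.coe_subset.2 (Finset.union_subset_union_right fun e he => ?_))
      rw [mem_level] at he ⊢
      rw [hl'S e he.1] at he
      exact ⟨hSA e he.1, he.2⟩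
    · rw [Finset.disjoint_left]
      intro e h1 h2
      rw [Finset.mem_filter] at h1
      rw [mem_level] at h2
      omega
  · intro t ht e he
    by_cases hlt : t < l e
    · refine mem_closure_trans (h.dom t ht e hlt) fun x hx => hup t x ?_
      rw [mem_upper] at hx ⊢
      exact ⟨Finset.mem_union_left _ hx.1, hx.2⟩
    -- Otherwise `e` has just risen from `t`: it was rejected, hence spanned by the demand at `t`,
    -- or dropped, hence itself in `upper l (S ∪ T) t`.
    have hlte : l e = t := by have := hle' e; omega
    have hr : e ∈ R ∨ (e ∈ S ∪ T ∧ e ∉ S') := by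
      by_contra hr
      simp only [hl', if_neg hr] at he
      omega
    rcases hr with hr | hr
    · refine mem_closure_trans (hsel.rej e hr) fun x hx => ?_
      rw [hlte] at hx
      exact hup t x (hdemA t hx)
    · refine hup t e ?_
      rw [mem_upper]
      exact ⟨hr.1, hlte.ge⟩
  · have : (S ∪ T).card ≤ n := by simpa using Finset.card_le_univ (S ∪ T)
    omega
  · have h1 : ∀ t ∈ Finset.range k,
        (upper l S t).card + (level l T t).card ≤ (upper l' S' t).card := by
      intro t ht
      rw [Finset.mem_range] at ht
      rw [← Finset.card_union_of_disjoint]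
      · exact card_le_card_of_span (hsel.demand_indep t ht) fun x hx => hup t x (hdemA t hx)
      · exact hST.mono (Finset.filter_subset _ _) (Finset.filter_subset _ _)
    -- What is still at level at most `t` was below `t`, or was at `t` and not rejected; in both
    -- cases `supply` at `t` spans it.
    have h2 : ∀ t ∈ Finset.range k, min (frk (M false) (lower l' (t + 1))) c ≤
        min (frk (M false) (lower l t)) c + (level l S t).card + (level l T t).card := by
      intro t ht
      rw [Finset.mem_range] at ht
      have h3 : frk (M false) (lower l' (t + 1)) ≤ (supply l B S T t).card := by
        refine frk_le_card_of_span (hE false) fun e he => ?_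
        rw [mem_lower] at he
        have := hle e
        by_cases hlt : l e < t
        · refine mem_closure_mono (hBs e) fun x hx => ?_
          rw [supply, Finset.mem_union, Finset.mem_filter]
          rw [Finset.mem_filter] at hx
          exact Or.inl ⟨hx.1, by omega⟩
        · have hlte : l e = t := by omega
          have := hsel.rest e trivial (by omega) fun hR => by
            simp only [hl', hR, true_or, if_true] at he
            omega
          rwa [hlte] at this
      have h4 : (supply l B S T t).card ≤ (B.filter fun x => l x < t).card +
          ((level l S t).card + (level l T t).card) := by
        refine (Finset.card_union_le _ _).trans ?_
        rw [level, Finset.filter_union]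
        gcongr
        exact Finset.card_union_le _ _
      have h5 : (B.filter fun x => l x < t).card ≤ frk (M false) (lower l t) :=
        card_le_frk (hE false) (hB.subset (Finset.coe_subset.2 (Finset.filter_subset _ _)))
          fun e he => mem_lower.2 (Finset.mem_filter.1 he).2
      omega
    have s1 := Finset.sum_le_sum h1
    have s2 := Finset.sum_le_sum h2
    simp only [Finset.sum_add_distrib] at s1 s2
    rw [sum_card_level l S k h.lt] at s2
    -- The two ways to split off an end term compare the rank sums over `t` and over `t + 1`.
    have s3 := Finset.sum_range_succ (fun t => min (frk (M false) (lower l t)) c) k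
    have s4 := Finset.sum_range_succ' (fun t => min (frk (M false) (lower l t)) c) k
    have s5 : lower l 0 = ∅ := by ext; simp [mem_lower]
    rw [s5, frk_empty (hE false)] at s4
    simp only [potential, Finset.sum_sub_distrib]
    simp only [← Nat.cast_sum]
    omega

/-- `N` rounds of the auction with `k` levels; the last component of the state is the largest set
that was held. -/
noncomputable def rounds (k N : ℕ) : QTree n ((Finset (Fin n) × (Fin n → ℕ)) × Finset (Fin n)) :=
  fold (fun s _ => (round k s.1).bind fun s' =>
    ret (s', if s.2.card ≤ s'.1.card then s'.1 else s.2)) ((∅, fun _ => 0), ∅) (List.range N)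

/-- The auction: a strategy that finds a common independent set of almost maximum size. -/
noncomputable def auction (k : ℕ) : QTree n (Finset (Fin n)) :=
  -- The potential has range `2 * k * r`. With `2 * k ^ 2` rounds its average increase is at most `r
  -- / k`.
  (rounds k (2 * k ^ 2)).bind fun s => ret s.2

/-- This is why the ranks are capped: without the cap the range would depend on the rank of the
first matroid instead of on `r`. -/
theorem abs_potential_le {M : Bool → Matroid (Fin n)} {k c : ℕ} {s : Finset (Fin n) × (Fin n → ℕ)}
    (h : s.1.card ≤ c) : |potential (M false) k c s| ≤ k * c := by
  unfold potential
  refine (Finset.abs_sum_le_sum_abs _ _).trans ?_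
  have : ∀ t ∈ Finset.range k, |(((upper s.2 s.1 t).card : ℤ) -
      (min (frk (M false) (lower s.2 (t + 1))) c : ℕ))| ≤ c := by
    intro t _
    have : (upper s.2 s.1 t).card ≤ s.1.card := Finset.card_filter_le _ _
    rw [abs_le]
    constructor <;> omega
  simpa using Finset.sum_le_sum this

/-- By `Inv.mul_card_le`, a round that starts from `S` multiplies out to `k * gain ≥ k * r - (k + 1)
* |S|`. Summing over the rounds and bounding every `|S|` by the best one gives the claim from the
range of the potential. -/
theorem auction_spec {M : Bool → Matroid (Fin n)} (hE : ∀ b, (M b).E = Set.univ) {k : ℕ}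
    (hk : 0 < k) {I : Finset (Fin n)} (h1 : (M false).Indep (I : Set (Fin n)))
    (h2 : (M true).Indep (I : Set (Fin n)))
    (hI : ∀ J : Finset (Fin n), (M false).Indep (J : Set (Fin n)) →
      (M true).Indep (J : Set (Fin n)) → J.card ≤ I.card) :
    (M false).Indep (((auction k).val M : Finset (Fin n)) : Set (Fin n)) ∧
    (M true).Indep (((auction k).val M : Finset (Fin n)) : Set (Fin n)) ∧
    k * I.card ≤ (k + 1) * ((auction k).val M).card + I.card ∧
    (auction k).cost M ≤ 8 * k ^ 2 * n := by
  have key := fold_induction M (fun (s : (Finset (Fin n) × (Fin n → ℕ)) × Finset (Fin n)) (_ : ℕ) =>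
      (round k s.1).bind fun s' =>
        ret (s', if s.2.card ≤ s'.1.card then s'.1 else s.2))
    (fun pre (s : (Finset (Fin n) × (Fin n → ℕ)) × Finset (Fin n)) c => Inv M k s.1.1 s.1.2 ∧
      (M false).Indep (s.2 : Set (Fin n)) ∧ (M true).Indep (s.2 : Set (Fin n)) ∧
      s.1.1.card ≤ s.2.card ∧ c ≤ 4 * n * pre.length ∧
      (pre.length : ℤ) * (k * I.card - (k + 1) * s.2.card) ≤
        k * (potential (M false) k I.card s.1 + k * I.card))
    (List.range (2 * k ^ 2)) ((∅, fun _ => 0), ∅) ?_ ?_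
  · obtain ⟨hinv, i1, i2, -, hc, hp⟩ := key
    have hv : (auction k).val M = ((rounds k (2 * k ^ 2)).val M).2 := by simp [auction]
    have hcost : (auction k).cost M = (rounds (n := n) k (2 * k ^ 2)).cost M := by simp [auction]
    have hv' : ((rounds k (2 * k ^ 2)).val M) = (fold (fun (s : (Finset (Fin n) × (Fin n → ℕ)) ×
        Finset (Fin n)) (_ : ℕ) => (round k s.1).bind fun s' =>
          ret (s', if s.2.card ≤ s'.1.card then s'.1 else s.2))
      ((∅, fun _ => 0), ∅) (List.range (2 * k ^ 2))).val M := rfl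
    have hc' : (rounds k (2 * k ^ 2)).cost M = (fold (fun (s : (Finset (Fin n) × (Fin n → ℕ)) ×
        Finset (Fin n)) (_ : ℕ) => (round k s.1).bind fun s' =>
          ret (s', if s.2.card ≤ s'.1.card then s'.1 else s.2))
      ((∅, fun _ => 0), ∅) (List.range (2 * k ^ 2))).cost M := rfl
    rw [← hv', ← hv] at i1 i2 hp
    rw [← hc', ← hcost] at hc
    rw [List.length_range] at hc hp
    refine ⟨i1, i2, ?_, hc.trans (by ring_nf; rfl)⟩
    have hS : ((rounds k (2 * k ^ 2)).val M).1.1.card ≤ I.card := by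
      rw [hv']
      exact hI _ hinv.indep_false hinv.indep
    have := (le_abs_self _).trans (abs_potential_le (M := M) (k := k) hS)
    set b := ((auction k).val M).card
    have hk2 : (0 : ℤ) < 2 * k ^ 2 := by positivity
    have h3 : (2 * k ^ 2 : ℤ) * (k * I.card - (k + 1) * b) ≤ 2 * k ^ 2 * I.card := by
      push_cast at hp
      nlinarith [Int.natCast_nonneg k]
    have h4 := le_of_mul_le_mul_left h3 hk2
    zify
    linarith
  · refine ⟨⟨by simp, by simp, fun t _ Y _ hY => by simpa [level] using hY, by simp⟩, by simp,
      by simp, by simp, by simp, ?_⟩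
    have := abs_potential_le (M := M) (k := k) (c := I.card)
      (s := ((∅ : Finset (Fin n)), fun _ => 0)) (by simp)
    have := neg_le_of_abs_le this
    simp only [List.length_nil, Nat.cast_zero, zero_mul]
    apply mul_nonneg <;> linarith [Int.natCast_nonneg k]
  · rintro pre b post ⟨⟨S, l⟩, best⟩ c - ⟨hinv, i1, i2, hle, hc, hp⟩
    simp only at hinv i1 i2 hle hp
    simp only [val_bind, cost_bind, val_ret, cost_ret, List.length_append, List.length_singleton]
    obtain ⟨hinv', hcost, hpot⟩ := round_spec hE (s := (S, l)) hinv I.card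
    simp only at hpot
    generalize (round k (S, l)).val M = s' at hinv' hpot ⊢
    set best' := if best.card ≤ s'.1.card then s'.1 else best with hb
    have hbest : best.card ≤ best'.card ∧ s'.1.card ≤ best'.card := by
      rw [hb]
      split_ifs with h
      · exact ⟨h, le_rfl⟩
      · exact ⟨le_rfl, by omega⟩
    refine ⟨hinv', ?_, ?_, hbest.2, ?_, ?_⟩
    · rw [hb]
      split_ifs
      · exact hinv'.indep_false
      · exact i1
    · rw [hb]
      split_ifs
      · exact hinv'.indep
      · exact i2
    · nlinarith
    -- The near-optimality bound survives the cap, since it is trivial when the rank reaches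
    -- `I.card`.
    · have hm : k * I.card ≤ k * min (frk (M false) (lower l k)) I.card + S.card := by
        rcases le_total (frk (M false) (lower l k)) I.card with h | h
        · rw [min_eq_left h]
          exact hinv.mul_card_le hE h1 h2
        · rw [min_eq_right h]
          omega
      zify at hm hle hbest
      push_cast at hpot hm ⊢
      nlinarith [mul_le_mul_of_nonneg_left hpot (Int.natCast_nonneg k),
        mul_nonneg (Int.natCast_nonneg k) (sub_nonneg.2 hle),
        mul_le_mul_of_nonneg_left hbest.1
          (show (0 : ℤ) ≤ (pre.length + 1) * (k + 1) by positivity)]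

end Auction

/-! ### Exchanges: binary search, growing the reached set, and valid routes. -/

namespace Augment

open QTree

variable {n : ℕ}

theorem notMem_closure_of_indep_insert {M : Matroid (Fin n)} {I : Finset (Fin n)} {e : Fin n}
    (h : M.Indep ((insert e I : Finset (Fin n)) : Set (Fin n))) (he : e ∉ I) :
    e ∉ M.closure (I : Set (Fin n)) := by
  rw [Finset.coe_insert] at h
  have := h.notMem_closure_sdiff_of_mem (Set.mem_insert e _)
  rwa [Set.insert_sdiff_of_mem _ (Set.mem_singleton e),
    Set.sdiff_singleton_eq_self (by simpa using he)] at this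

theorem indep_insert_of_notMem_closure {M : Matroid (Fin n)} (hE : M.E = Set.univ)
    {I : Finset (Fin n)} {e : Fin n} (hI : M.Indep (I : Set (Fin n)))
    (he : e ∉ M.closure (I : Set (Fin n))) :
    M.Indep ((insert e I : Finset (Fin n)) : Set (Fin n)) := by
  by_contra h
  exact he (mem_closure_of_not_indep_insert hE hI h)

/-- Binary search in the list `X` of elements of `S` for an element of the fundamental circuit of
`v` in the matroid `b`. -/
def search (b : Bool) (S : Finset (Fin n)) (v : Fin n) : ℕ → List (Fin n) → QTree n (Fin n)
  | 0, X => ret (X.headD v)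
  | d + 1, X => ask b (insert v (S \ (X.take (2 ^ d)).toFinset)) fun a =>
      if a then search b S v d (X.take (2 ^ d)) else search b S v d (X.drop (2 ^ d))

/-- Removing `X` from `S` frees `v`. If removing the first half does not, removing the second half
must: otherwise `v` would be spanned by the intersection of the two remainders, which is `S` without
`X`. -/
theorem search_spec {M : Bool → Matroid (Fin n)} (hE : ∀ b, (M b).E = Set.univ) {b : Bool}
    {S : Finset (Fin n)} (hS : (M b).Indep (S : Set (Fin n))) {v : Fin n} (hvS : v ∉ S)
    (hv : v ∈ (M b).closure (S : Set (Fin n))) (d : ℕ) (X : List (Fin n)) (hd : X.length ≤ 2 ^ d)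
    (hvX : v ∉ (M b).closure ((S \ X.toFinset : Finset _) : Set (Fin n))) :
    (search b S v d X).val M ∈ X ∧
    v ∉ (M b).closure ((S \ {(search b S v d X).val M} : Finset _) : Set (Fin n)) ∧
    (search b S v d X).cost M = d := by
  induction d generalizing X with
  | zero =>
    match X, hd, hvX with
    -- The default value of `headD` is never returned, because `v` is spanned by the whole of `S`.
    | [], _, hvX => exact absurd hv (by simpa using hvX)
    | [u], _, hvX => simpa [search] using hvX
  | succ d ih =>
    by_cases h : (M b).Indep
        ((insert v (S \ (X.take (2 ^ d)).toFinset) : Finset (Fin n)) : Set (Fin n))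
    · rw [search, val_ask_of_indep _ _ h, cost_ask_of_indep _ _ h]
      simp only [if_true]
      obtain ⟨h1, h2, h3⟩ := ih (X.take (2 ^ d)) (by simp)
        (notMem_closure_of_indep_insert h (by simp [hvS]))
      exact ⟨List.mem_of_mem_take h1, h2, by omega⟩
    · rw [search, val_ask_of_not_indep _ _ h, cost_ask_of_not_indep _ _ h]
      simp only [Bool.false_eq_true, if_false]
      have hc := mem_closure_of_not_indep_insert (hE b)
        (hS.subset (Finset.coe_subset.2 Finset.sdiff_subset)) h
      obtain ⟨h1, h2, h3⟩ := ih (X.drop (2 ^ d)) (by simp; rw [pow_succ] at hd; omega) fun hc' => by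
        refine hvX (mem_closure_mono
          (mem_closure_inter hS Finset.sdiff_subset Finset.sdiff_subset hc hc') fun x hx => ?_)
        simp only [Finset.mem_inter, Finset.mem_sdiff, List.mem_toFinset] at hx ⊢
        refine ⟨hx.1.1, fun hX => ?_⟩
        rw [← List.take_append_drop (2 ^ d) X, List.mem_append] at hX
        tauto
      exact ⟨List.mem_of_mem_drop h1, h2, by omega⟩

/-- Enlarge a subset of `S` until it spans `v` in the first matroid, by elements of the fundamental
circuit of `v`; label them with `XY`. -/
noncomputable def grow (S : Finset (Fin n)) (v : Fin n) (d : ℕ)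
    (XY : Finset (Fin n) × Finset (Fin n)) :
    ℕ → Finset (Fin n) × (Fin n → Finset (Fin n) × Finset (Fin n)) →
      QTree n (Finset (Fin n) × (Fin n → Finset (Fin n) × Finset (Fin n)))
  | 0, s => ret s
  | f + 1, s => ask false (insert v s.1) fun a =>
      if a then (search false S v d (S \ s.1).toList).bind fun u =>
        grow S v d XY f (insert u s.1, Function.update s.2 u XY)
      else ret s

/-- Each new element pays for one query and one binary search, and one last query detects that `v`
is spanned. The cost is thus amortized against the size of the reached set. -/
theorem grow_spec {M : Bool → Matroid (Fin n)} (hE : ∀ b, (M b).E = Set.univ)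
    {S : Finset (Fin n)} (hS : (M false).Indep (S : Set (Fin n))) {v : Fin n} (hvS : v ∉ S)
    (hv : v ∈ (M false).closure (S : Set (Fin n))) {d : ℕ} (hd : S.card ≤ 2 ^ d)
    (XY : Finset (Fin n) × Finset (Fin n)) (f : ℕ)
    (s : Finset (Fin n) × (Fin n → Finset (Fin n) × Finset (Fin n))) (hU : s.1 ⊆ S)
    (hf : (S \ s.1).card ≤ f) :
    s.1 ⊆ ((grow S v d XY f s).val M).1 ∧ ((grow S v d XY f s).val M).1 ⊆ S ∧
    v ∈ (M false).closure (((grow S v d XY f s).val M).1 : Set (Fin n)) ∧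
    (∀ u ∈ ((grow S v d XY f s).val M).1, u ∉ s.1 →
      v ∉ (M false).closure ((S \ {u} : Finset _) : Set (Fin n)) ∧
      ((grow S v d XY f s).val M).2 u = XY) ∧
    (∀ u ∈ s.1, ((grow S v d XY f s).val M).2 u = s.2 u) ∧
    (grow S v d XY f s).cost M + s.1.card * (d + 1) ≤
      1 + ((grow S v d XY f s).val M).1.card * (d + 1) := by
  induction f generalizing s with
  | zero =>
    have hUS : s.1 = S := by
      rw [Nat.le_zero, Finset.card_eq_zero, Finset.sdiff_eq_empty_iff_subset] at hf
      exact hU.antisymm hf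
    simp only [grow, val_ret, cost_ret]
    exact ⟨subset_rfl, hU, hUS ▸ hv, fun u hu hu' => absurd hu hu', fun _ _ => trivial, by omega⟩
  | succ f ih =>
    obtain ⟨U, D⟩ := s
    simp only at hU hf ⊢
    have hUi : (M false).Indep (U : Set (Fin n)) := hS.subset (Finset.coe_subset.2 hU)
    by_cases h : (M false).Indep ((insert v U : Finset (Fin n)) : Set (Fin n))
    · rw [grow, val_ask_of_indep _ _ h, cost_ask_of_indep _ _ h]
      simp only [if_true, val_bind, cost_bind]
      obtain ⟨h1, h2, h3⟩ := search_spec hE hS hvS hv d (S \ U).toList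
        (by rw [Finset.length_toList]; exact (Finset.card_le_card Finset.sdiff_subset).trans hd)
        (by
          rw [Finset.toList_toFinset, Finset.sdiff_sdiff_eq_self hU]
          exact notMem_closure_of_indep_insert h fun hvU => hvS (hU hvU))
      rw [h3]
      generalize (search false S v d (S \ U).toList).val M = u at h1 h2 ⊢
      rw [Finset.mem_toList, Finset.mem_sdiff] at h1
      obtain ⟨g1, g2, g3, g4, g5, g6⟩ := ih (insert u U, Function.update D u XY)
        (Finset.insert_subset h1.1 hU) (by
          have : S \ insert u U ⊂ S \ U := by
            rw [Finset.ssubset_iff_of_subset (Finset.sdiff_subset_sdiff subset_rfl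
              (Finset.subset_insert _ _))]
            exact ⟨u, by simp [h1], by simp⟩
          have := Finset.card_lt_card this
          simp only
          omega)
      simp only at g1 g4 g5 g6
      generalize (grow S v d XY f (insert u U, Function.update D u XY)).val M = s'
        at g1 g2 g3 g4 g5 g6 ⊢
      refine ⟨(Finset.subset_insert _ _).trans g1, g2, g3, ?_, ?_, ?_⟩
      · intro x hx hxU
        by_cases hxu : x = u
        · subst hxu
          refine ⟨h2, ?_⟩
          rw [g5 x (Finset.mem_insert_self _ _), Function.update_self]
        · exact g4 x hx (by simp [hxu, hxU])
      · intro x hx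
        rw [g5 x (Finset.mem_insert_of_mem hx), Function.update_of_ne]
        rintro rfl
        exact h1.2 hx
      · rw [Finset.card_insert_of_notMem h1.2] at g6
        rw [add_mul] at g6
        omega
    · rw [grow, val_ask_of_not_indep _ _ h, cost_ask_of_not_indep _ _ h]
      simp only [Bool.false_eq_true, if_false, val_ret, cost_ret]
      exact ⟨subset_rfl, hU, mem_closure_of_not_indep_insert (hE _) hUi h,
        fun u hu hu' => absurd hu hu', fun _ _ => trivial, by omega⟩

/-- The exchange `Y ↔ X` ends in `v ∈ X`: it is valid in the second matroid, and also in the first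
matroid once `v` can be added there. -/
structure Reach (M : Bool → Matroid (Fin n)) (S A U : Finset (Fin n)) (v : Fin n)
    (X Y : Finset (Fin n)) : Prop where
  subY : Y ⊆ U
  subX : X ⊆ insert v A
  card : X.card = Y.card + 1
  indep_true : (M true).Indep (((S \ Y) ∪ X : Finset _) : Set (Fin n))
  indep_false : ∀ J : Finset (Fin n), (M false).Indep (J : Set (Fin n)) → U ⊆ J → v ∈ J →
    (M false).Indep (((J \ Y) ∪ X : Finset _) : Set (Fin n))

/-- The exchange `Y ↔ X` leads to `u`, the next element to be removed. -/
structure Good (M : Bool → Matroid (Fin n)) (S A U : Finset (Fin n)) (u : Fin n)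
    (X Y : Finset (Fin n)) : Prop where
  subY : Y ⊆ U
  notMem : u ∉ Y
  subX : X ⊆ A
  card : X.card = Y.card + 1
  indep_true : (M true).Indep (((S \ Y) ∪ X : Finset _) : Set (Fin n))
  indep_false : ∀ J : Finset (Fin n), (M false).Indep (J : Set (Fin n)) → U ⊆ J →
    (M false).Indep (((J \ insert u Y) ∪ X : Finset _) : Set (Fin n))

/-- The invariant of the breadth-first search for an augmentation of `S`: the elements `A` outside
`S` and `U` inside `S` have been reached, and `D` labels the latter with exchanges. -/
structure Searched (M : Bool → Matroid (Fin n)) (S A U : Finset (Fin n))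
    (D : Fin n → Finset (Fin n) × Finset (Fin n)) : Prop where
  disj : ∀ v ∈ A, v ∉ S
  sub : U ⊆ S
  span : ∀ v ∈ A, v ∈ (M false).closure (U : Set (Fin n))
  good : ∀ u ∈ U, Good M S A U u (D u).1 (D u).2
  short : ∀ u ∈ U, ∀ v, v ∉ S → v ∉ A →
    v ∈ (M true).closure ((S \ (D u).2 : Finset _) : Set (Fin n)) ∨
    v ∈ (M true).closure ((S \ {u} : Finset _) : Set (Fin n))

/-- Find an exchange that ends in `v`. -/
noncomputable def route (S U : Finset (Fin n)) (D : Fin n → Finset (Fin n) × Finset (Fin n)) (d : ℕ)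
    (v : Fin n) : QTree n (Finset (Fin n) × Finset (Fin n)) :=
  ask true (insert v S) fun a =>
    if a then ret ({v}, ∅)
    else (search true S v d U.toList).bind fun u => ret (insert v (D u).1, insert u (D u).2)

/-- If `v` cannot simply be added to `S` in the second matroid, the route of some reached `u` is
prolonged by the swap of `u` for `v`. The field `short` excludes shortcuts: the elements removed
earlier on that route do not free `v`, and this keeps the combined exchange independent. -/
theorem route_spec {M : Bool → Matroid (Fin n)} (hE : ∀ b, (M b).E = Set.univ)
    {S A U : Finset (Fin n)} {D : Fin n → Finset (Fin n) × Finset (Fin n)}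
    (hS : (M true).Indep (S : Set (Fin n))) (h : Searched M S A U D) {d : ℕ}
    (hd : S.card ≤ 2 ^ d) {v : Fin n} (hvS : v ∉ S) (hvA : v ∉ A)
    (hv : v ∉ (M true).closure ((S \ U : Finset _) : Set (Fin n)))
    {D' : Fin n → Finset (Fin n) × Finset (Fin n)} (hD : ∀ u ∈ U, D' u = D u) :
    Reach M S A U v ((route S U D' d v).val M).1 ((route S U D' d v).val M).2 ∧
    (route S U D' d v).cost M ≤ d + 1 := by
  by_cases hs : (M true).Indep ((insert v S : Finset (Fin n)) : Set (Fin n))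
  · rw [route, val_ask_of_indep _ _ hs, cost_ask_of_indep _ _ hs]
    simp only [if_true, val_ret, cost_ret]
    refine ⟨⟨by simp, by simp, by simp, ?_, ?_⟩, by omega⟩
    · rw [Finset.sdiff_empty, Finset.union_comm]
      exact hs
    · intro J hJ _ hvJ
      rw [Finset.sdiff_empty, Finset.union_eq_left.2 (by simpa using hvJ)]
      exact hJ
  · rw [route, val_ask_of_not_indep _ _ hs, cost_ask_of_not_indep _ _ hs]
    simp only [Bool.false_eq_true, if_false, val_bind, cost_bind, val_ret, cost_ret]
    obtain ⟨h1, h2, h3⟩ := search_spec hE hS hvS (mem_closure_of_not_indep_insert (hE _) hS hs) d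
      U.toList (by rw [Finset.length_toList]; exact (Finset.card_le_card h.sub).trans hd)
      (by rwa [Finset.toList_toFinset])
    rw [h3]
    generalize (search true S v d U.toList).val M = u at h1 h2 ⊢
    rw [Finset.mem_toList] at h1
    rw [hD u h1]
    have hg := h.good u h1
    have hsh := (h.short u h1 v hvS hvA).resolve_right h2
    generalize (D u).1 = X at hg hsh ⊢
    generalize (D u).2 = Y at hg hsh ⊢
    have huX : u ∉ X := fun hu => h.disj u (hg.subX hu) (h.sub h1)
    have hvX : v ∉ X := fun hv => hvA (hg.subX hv)
    refine ⟨⟨?_, ?_, ?_, ?_, ?_⟩, by omega⟩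
    · exact Finset.insert_subset h1 hg.subY
    · exact Finset.insert_subset_insert _ hg.subX
    · rw [Finset.card_insert_of_notMem hvX, Finset.card_insert_of_notMem hg.notMem, hg.card]
    · have hZ : (M true).Indep (((((S \ Y) ∪ X) \ {u}) : Finset _) : Set (Fin n)) :=
        hg.indep_true.subset (Finset.coe_subset.2 Finset.sdiff_subset)
      refine (indep_insert_of_notMem_closure (hE _) (e := v) hZ fun hc => ?_).subset ?_
      -- If `v` were spanned after the removal of `u`, intersecting with its span by `S \ Y` would
      -- leave it spanned by `S \ {u}`.
      · refine h2 (mem_closure_mono (mem_closure_inter hg.indep_true Finset.sdiff_subset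
          Finset.subset_union_left hc hsh) fun x hx => ?_)
        simp only [Finset.mem_inter, Finset.mem_sdiff] at hx ⊢
        exact ⟨hx.2.1, hx.1.2⟩
      · rw [Finset.coe_subset]
        intro x hx
        simp only [Finset.mem_union, Finset.mem_sdiff, Finset.mem_insert,
          Finset.mem_singleton] at hx ⊢
        rcases hx with hx | rfl | hx
        · tauto
        · exact Or.inl rfl
        · refine Or.inr ⟨Or.inr hx, ?_⟩
          rintro rfl
          exact huX hx
    · intro J hJ hUJ hvJ
      refine (hg.indep_false J hJ hUJ).subset ?_
      rw [Finset.coe_subset]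
      intro x hx
      simp only [Finset.mem_union, Finset.mem_sdiff, Finset.mem_insert] at hx ⊢
      rcases hx with hx | rfl | hx
      · exact Or.inl hx
      · refine Or.inl ⟨hvJ, ?_⟩
        rintro (rfl | hx)
        · exact hvS (h.sub h1)
        · exact hvS (h.sub (hg.subY hx))
      · exact Or.inr hx

end Augment

/-! ### Breadth-first layers and repeated augmentation. -/

namespace Augment

open QTree

variable {n : ℕ}

/-- A state of the breadth-first search: the reached elements outside and inside `S`, the labels of
the latter, and the augmented set if one has been found. -/
abbrev State (n : ℕ) : Type :=
  Finset (Fin n) × (Finset (Fin n) × (Fin n → Finset (Fin n) × Finset (Fin n))) ×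
    Option (Finset (Fin n))

/-- Consider the element `v` in the layer that starts from the elements `U` of `S`. -/
noncomputable def visit (S U : Finset (Fin n)) (d : ℕ) (s : State n) (v : Fin n) :
    QTree n (State n) :=
  if v ∈ S ∨ v ∈ s.1 ∨ s.2.2.isSome then ret s
  else ask true (insert v (S \ U)) fun a =>
    if a then (route S U s.2.1.2 d v).bind fun XY => ask false (insert v S) fun a' =>
      if a' then ret (s.1, s.2.1, some ((S \ XY.2) ∪ XY.1))
      else (grow S v d XY S.card s.2.1).bind fun UD => ret (insert v s.1, UD, none)
    else ret s

/-- One layer of the breadth-first search. -/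
noncomputable def layer (S : Finset (Fin n)) (d : ℕ) (s : State n) : QTree n (State n) :=
  fold (visit S s.2.1.1 d) s Finset.univ.toList

/-- `S'` is a common independent set with one more element than `S`. -/
structure Augments (M : Bool → Matroid (Fin n)) (S S' : Finset (Fin n)) : Prop where
  indep : ∀ b, (M b).Indep (S' : Set (Fin n))
  card : S'.card = S.card + 1

/-- The invariant within a layer that started with `A`, `U`, `D`, after the elements of `P`. -/
structure Mid (M : Bool → Matroid (Fin n)) (S A U : Finset (Fin n))
    (D : Fin n → Finset (Fin n) × Finset (Fin n)) (P : Fin n → Prop) (A' U' : Finset (Fin n))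
    (D' : Fin n → Finset (Fin n) × Finset (Fin n)) : Prop where
  subA : A ⊆ A'
  subU : U ⊆ U'
  disj : ∀ v ∈ A', v ∉ S
  sub : U' ⊆ S
  span : ∀ v ∈ A', v ∈ (M false).closure (U' : Set (Fin n))
  label : ∀ u ∈ U, D' u = D u
  good : ∀ u ∈ U', Good M S A' U' u (D' u).1 (D' u).2
  fresh : ∀ u ∈ U', u ∉ U → (D' u).2 ⊆ U
  done : ∀ v, P v → v ∉ S → v ∈ A' ∨ v ∈ (M true).closure ((S \ U : Finset _) : Set (Fin n))

theorem Good.mono {M : Bool → Matroid (Fin n)} {S A U A' U' X Y : Finset (Fin n)} {u : Fin n}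
    (h : Good M S A U u X Y) (hA : A ⊆ A') (hU : U ⊆ U') : Good M S A' U' u X Y :=
  { h with
    subY := h.subY.trans hU
    subX := h.subX.trans hA
    indep_false := fun J hJ hUJ => h.indep_false J hJ (hU.trans hUJ) }

/-- Take `J = insert v S` in the exchange property for the first matroid. -/
theorem Reach.augments {M : Bool → Matroid (Fin n)} {S A U X Y : Finset (Fin n)} {v : Fin n}
    (h : Reach M S A U v X Y) (hA : ∀ x ∈ A, x ∉ S) (hU : U ⊆ S) (hv : v ∉ S)
    (hi : (M false).Indep ((insert v S : Finset (Fin n)) : Set (Fin n))) :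
    Augments M S ((S \ Y) ∪ X) := by
  constructor
  · rintro (_ | _)
    · refine (h.indep_false _ hi (hU.trans (Finset.subset_insert _ _))
        (Finset.mem_insert_self _ _)).subset (Finset.coe_subset.2 ?_)
      gcongr
      exact Finset.subset_insert _ _
    · exact h.indep_true
  · rw [Finset.card_union_of_disjoint, Finset.card_sdiff_of_subset (h.subY.trans hU), h.card]
    · have := Finset.card_le_card (h.subY.trans hU)
      omega
    · rw [Finset.disjoint_left]
      intro x hx hxX
      rw [Finset.mem_sdiff] at hx
      rcases Finset.mem_insert.1 (h.subX hxX) with rfl | hxA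
      · exact hv hx.1
      · exact hA x hxA hx.1

/-- In any independent `J ⊇ U'` the fundamental circuit of `v` lies in `insert v U'` and contains
`u`. So `u` may be swapped for `v`, and the route to `v` applies to the result because `u` is not in
`U`. -/
theorem Reach.good {M : Bool → Matroid (Fin n)} (hE : ∀ b, (M b).E = Set.univ)
    {S A U A' U' X Y : Finset (Fin n)} {v u : Fin n}
    (h : Reach M S A U v X Y) (hA : A ⊆ A') (hU : U ⊆ U') (huU : u ∈ U') (hu : u ∉ U)
    (hv : v ∈ (M false).closure (U' : Set (Fin n)))
    (hvu : v ∉ (M false).closure ((U' \ {u} : Finset _) : Set (Fin n))) :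
    Good M S (insert v A') U' u X Y where
  subY := h.subY.trans hU
  notMem hY := hu (h.subY hY)
  subX := h.subX.trans (Finset.insert_subset_insert _ hA)
  card := h.card
  indep_true := h.indep_true
  indep_false J hJ hUJ := by
    have h1 : (M false).Indep ((insert v (J \ {u}) : Finset (Fin n)) : Set (Fin n)) := by
      refine indep_insert_of_notMem_closure (hE _)
        (hJ.subset (Finset.coe_subset.2 Finset.sdiff_subset)) fun hc => ?_
      refine hvu (mem_closure_mono (mem_closure_inter hJ Finset.sdiff_subset hUJ hc hv)
        fun x hx => ?_)
      simp only [Finset.mem_inter, Finset.mem_sdiff] at hx ⊢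
      exact ⟨hx.2, hx.1.2⟩
    refine (h.indep_false _ h1 ?_ (Finset.mem_insert_self _ _)).subset ?_
    · intro x hx
      simp only [Finset.mem_insert, Finset.mem_sdiff, Finset.mem_singleton]
      refine Or.inr ⟨hUJ (hU hx), ?_⟩
      rintro rfl
      exact hu hx
    · rw [Finset.coe_subset]
      intro x hx
      simp only [Finset.mem_union, Finset.mem_sdiff, Finset.mem_insert,
        Finset.mem_singleton] at hx ⊢
      tauto

theorem visit_spec {M : Bool → Matroid (Fin n)} (hE : ∀ b, (M b).E = Set.univ)
    {S A U : Finset (Fin n)} {D : Fin n → Finset (Fin n) × Finset (Fin n)}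
    (hS : ∀ b, (M b).Indep (S : Set (Fin n))) (h : Searched M S A U D) {d : ℕ}
    (hd : S.card ≤ 2 ^ d) (P : Fin n → Prop) (s : State n) (v : Fin n)
    (h1 : ∀ S', s.2.2 = some S' → Augments M S S')
    (h2 : s.2.2 = none → Mid M S A U D P s.1 s.2.1.1 s.2.1.2) :
    (∀ S', ((visit S U d s v).val M).2.2 = some S' → Augments M S S') ∧
    (((visit S U d s v).val M).2.2 = none → Mid M S A U D (fun x => P x ∨ x = v)
      ((visit S U d s v).val M).1 ((visit S U d s v).val M).2.1.1
      ((visit S U d s v).val M).2.1.2) ∧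
    (visit S U d s v).cost M + s.2.1.1.card * (d + 1) ≤
      (d + 4) + ((visit S U d s v).val M).2.1.1.card * (d + 1) ∧
    (s.2.1.1 ⊆ S → ((visit S U d s v).val M).2.1.1 ⊆ S) := by
  obtain ⟨A', ⟨U', D'⟩, res⟩ := s
  simp only at h1 h2
  unfold visit
  simp only
  split_ifs with h0
  · refine ⟨h1, fun hr => ?_, by simp only [cost_ret, val_ret]; omega, fun h => h⟩
    simp only [val_ret] at hr ⊢
    have hm := h2 hr
    refine { hm with done := ?_ }
    rintro x (hx | rfl) hxS
    · exact hm.done x hx hxS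
    · simp only [hxS, hr, false_or, Option.isSome_none, Bool.false_eq_true, or_false] at h0
      exact Or.inl h0
  rw [not_or, not_or, Bool.not_eq_true, Option.isSome_eq_false_iff, Option.isNone_iff_eq_none] at h0
  obtain ⟨hvS, hvA', rfl⟩ := h0
  have hm := h2 rfl
  have hSU : (M true).Indep ((S \ U : Finset (Fin n)) : Set (Fin n)) :=
    (hS true).subset (Finset.coe_subset.2 Finset.sdiff_subset)
  by_cases hq : (M true).Indep ((insert v (S \ U) : Finset (Fin n)) : Set (Fin n))
  swap
  · rw [val_ask_of_not_indep _ _ hq, cost_ask_of_not_indep _ _ hq]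
    simp only [Bool.false_eq_true, if_false, val_ret, cost_ret]
    refine ⟨h1, fun _ => { hm with done := ?_ }, by omega, fun h => h⟩
    rintro x (hx | rfl) hxS
    · exact hm.done x hx hxS
    · exact Or.inr (mem_closure_of_not_indep_insert (hE _) hSU hq)
  rw [val_ask_of_indep _ _ hq, cost_ask_of_indep _ _ hq]
  simp only [if_true, val_bind, cost_bind]
  obtain ⟨r1, r2⟩ := route_spec hE (hS true) h hd hvS (fun hv => hvA' (hm.subA hv))
    (notMem_closure_of_indep_insert hq (by simp [hvS])) hm.label
  generalize (route S U D' d v).cost M = cr at r2 ⊢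
  generalize (route S U D' d v).val M = XY at r1 ⊢
  by_cases hi : (M false).Indep ((insert v S : Finset (Fin n)) : Set (Fin n))
  · rw [val_ask_of_indep _ _ hi, cost_ask_of_indep _ _ hi]
    simp only [if_true, val_ret, cost_ret]
    refine ⟨?_, by simp, by omega, fun h => h⟩
    intro S' hS'
    obtain rfl := Option.some.inj hS'
    exact r1.augments h.disj h.sub hvS hi
  rw [val_ask_of_not_indep _ _ hi, cost_ask_of_not_indep _ _ hi]
  simp only [Bool.false_eq_true, if_false, val_bind, cost_bind, val_ret, cost_ret]
  obtain ⟨g1, g2, g3, g4, g5, g6⟩ := grow_spec hE (hS false) hvS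
    (mem_closure_of_not_indep_insert (hE _) (hS false) hi) hd XY S.card (U', D') hm.sub
    (Finset.card_le_card Finset.sdiff_subset)
  simp only at g1 g4 g5 g6
  generalize (grow S v d XY S.card (U', D')).cost M = cg at g6 ⊢
  generalize (grow S v d XY S.card (U', D')).val M = UD at g1 g2 g3 g4 g5 g6 ⊢
  obtain ⟨U'', D''⟩ := UD
  simp only at g1 g2 g3 g4 g5 g6 ⊢
  refine ⟨by simp, fun _ => ?_, by omega, fun _ => g2⟩
  constructor
  · exact hm.subA.trans (Finset.subset_insert _ _)
  · exact hm.subU.trans g1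
  · intro x hx
    rcases Finset.mem_insert.1 hx with rfl | hx
    · exact hvS
    · exact hm.disj x hx
  · exact g2
  · intro x hx
    rcases Finset.mem_insert.1 hx with rfl | hx
    · exact g3
    · exact mem_closure_mono (hm.span x hx) g1
  · intro u hu
    rw [g5 u (hm.subU hu), hm.label u hu]
  · intro u hu
    by_cases huU : u ∈ U'
    · rw [g5 u huU]
      exact (hm.good u huU).mono (Finset.subset_insert _ _) g1
    · obtain ⟨k1, k2⟩ := g4 u hu huU
      rw [k2]
      exact r1.good hE hm.subA (hm.subU.trans g1) hu (fun h => huU (hm.subU h)) g3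
        fun hc => k1 (mem_closure_mono hc (Finset.sdiff_subset_sdiff g2 subset_rfl))
  · intro u hu huU
    by_cases huU' : u ∈ U'
    · rw [g5 u huU']
      exact hm.fresh u huU' huU
    · rw [(g4 u hu huU').2]
      exact r1.subY
  · rintro x (hx | rfl) hxS
    · rcases hm.done x hx hxS with h | h
      · exact Or.inl (Finset.mem_insert_of_mem h)
      · exact Or.inr h
    · exact Or.inl (Finset.mem_insert_self _ _)

/-- After a layer without augmentation, the second matroid spans every unreached outside element by
`S \ U`, and the first spans everything reached by the new `U'`. This covering gives `|I| ≤ |U'| +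
|S \ U|`, so at least `|I| - |S|` elements were gained. -/
theorem layer_spec {M : Bool → Matroid (Fin n)} (hE : ∀ b, (M b).E = Set.univ)
    {S : Finset (Fin n)} (hS : ∀ b, (M b).Indep (S : Set (Fin n))) (s : State n)
    (h : Searched M S s.1 s.2.1.1 s.2.1.2) (hs : s.2.2 = none) {d : ℕ} (hd : S.card ≤ 2 ^ d)
    {I : Finset (Fin n)} (hI : ∀ b, (M b).Indep (I : Set (Fin n))) :
    (∀ S', ((layer S d s).val M).2.2 = some S' → Augments M S S') ∧
    (((layer S d s).val M).2.2 = none →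
      Searched M S ((layer S d s).val M).1 ((layer S d s).val M).2.1.1
        ((layer S d s).val M).2.1.2 ∧
      I.card + s.2.1.1.card ≤ S.card + ((layer S d s).val M).2.1.1.card) ∧
    (layer S d s).cost M + s.2.1.1.card * (d + 1) ≤
      n * (d + 4) + ((layer S d s).val M).2.1.1.card * (d + 1) ∧
    ((layer S d s).val M).2.1.1 ⊆ S := by
  obtain ⟨A, ⟨U, D⟩, res⟩ := s
  simp only at h hs
  subst hs
  have key := fold_induction M (visit S U d) (fun pre (s : State n) c =>
    (∀ S', s.2.2 = some S' → Augments M S S') ∧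
    (s.2.2 = none → Mid M S A U D (· ∈ pre) s.1 s.2.1.1 s.2.1.2) ∧
    c + U.card * (d + 1) ≤ pre.length * (d + 4) + s.2.1.1.card * (d + 1) ∧ s.2.1.1 ⊆ S)
    Finset.univ.toList (A, (U, D), none) ?_ ?_
  · rw [show layer S d (A, (U, D), none) =
      fold (visit S U d) (A, (U, D), none) Finset.univ.toList from rfl]
    generalize (fold (visit S U d) (A, (U, D), none) Finset.univ.toList).val M = s at key ⊢
    obtain ⟨k1, k2, k3, k4⟩ := key
    obtain ⟨A', ⟨U', D'⟩, res⟩ := s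
    simp only [Finset.length_toList, Finset.card_univ, Fintype.card_fin] at k1 k2 k3 k4 ⊢
    refine ⟨k1, fun hr => ?_, k3, k4⟩
    have hm := k2 hr
    have hdone : ∀ v, v ∉ S → v ∈ A' ∨
        v ∈ (M true).closure ((S \ U : Finset _) : Set (Fin n)) :=
      fun v => hm.done v (by simp)
    refine ⟨⟨hm.disj, hm.sub, hm.span, hm.good, ?_⟩, ?_⟩
    · intro u hu v hvS hvA
      by_cases huU : u ∈ U
      · rw [hm.label u huU]
        exact h.short u huU v hvS fun hv => hvA (hm.subA hv)
      -- A label created in this layer removes only elements of the old `U`, and `S \ U` already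
      -- spans every `v` left unreached.
      · left
        exact mem_closure_mono ((hdone v hvS).resolve_left hvA)
          (Finset.sdiff_subset_sdiff subset_rfl (hm.fresh u hu huU))
    · have hc := card_le_of_cover (hE false) (hI false) (hI true) (P := A' ∪ U') (Q := S \ U)
        fun e => by
          by_cases heS : e ∈ S
          · by_cases heU : e ∈ U
            · exact Or.inl (Finset.mem_union_right _ (hm.subU heU))
            · exact Or.inr (mem_closure_of_mem (hE _) (by simp [heS, heU]))
          · rcases hdone e heS with h | h
            · exact Or.inl (Finset.mem_union_left _ h)
            · exact Or.inr h
      have hr1 : frk (M false) (A' ∪ U') ≤ U'.card :=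
        frk_le_card_of_span (hE _) fun x hx => by
          rcases Finset.mem_union.1 hx with hx | hx
          · exact hm.span x hx
          · exact mem_closure_of_mem (hE _) hx
      rw [Finset.card_sdiff_of_subset h.sub] at hc
      have := Finset.card_le_card h.sub
      omega
  · refine ⟨by simp, fun _ => ?_, by simp, h.sub⟩
    exact ⟨subset_rfl, subset_rfl, h.disj, h.sub, h.span, fun _ _ => rfl, h.good,
      fun u hu hu' => absurd hu hu', by simp⟩
  · rintro pre v post s c - ⟨k1, k2, k3, k4⟩
    obtain ⟨v1, v2, v3, v4⟩ := visit_spec hE hS h hd (· ∈ pre) s v k1 k2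
    refine ⟨v1, ?_, ?_, v4 k4⟩
    · simpa using v2
    · rw [List.length_append, List.length_singleton, add_mul]
      omega

/-- Up to `j` layers of the breadth-first search, or fewer if an augmentation is found. -/
noncomputable def layers (S : Finset (Fin n)) (d : ℕ) :
    ℕ → State n → QTree n (Option (Finset (Fin n)))
  | 0, _ => ret none
  | j + 1, s => (layer S d s).bind fun s' =>
      match s'.2.2 with
      | some S' => ret (some S')
      | none => layers S d j s'

/-- The reached part of `S` never exceeds `S`, so the gains of `j` failed layers bound the deficit,
and the amortized searches cost at most `S.card * (d + 1)` in total. -/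
theorem layers_spec {M : Bool → Matroid (Fin n)} (hE : ∀ b, (M b).E = Set.univ)
    {S : Finset (Fin n)} (hS : ∀ b, (M b).Indep (S : Set (Fin n))) {d : ℕ} (hd : S.card ≤ 2 ^ d)
    {I : Finset (Fin n)} (hI : ∀ b, (M b).Indep (I : Set (Fin n))) (j : ℕ) (s : State n)
    (h : Searched M S s.1 s.2.1.1 s.2.1.2) (hs : s.2.2 = none) :
    (∀ S', (layers S d j s).val M = some S' → Augments M S S') ∧
    ((layers S d j s).val M = none → j * I.card + s.2.1.1.card ≤ j * S.card + S.card) ∧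
    (layers S d j s).cost M + s.2.1.1.card * (d + 1) ≤ j * (n * (d + 4)) + S.card * (d + 1) := by
  induction j generalizing s with
  | zero =>
    have := Finset.card_le_card h.sub
    simp only [layers, val_ret, cost_ret]
    refine ⟨by simp, fun _ => by omega, ?_⟩
    have := Nat.mul_le_mul_right (d + 1) this
    omega
  | succ j ih =>
    obtain ⟨l1, l2, l3, l4⟩ := layer_spec hE hS s h hs hd hI
    simp only [layers, val_bind, cost_bind]
    generalize (layer S d s).val M = s' at l1 l2 l3 l4 ⊢
    obtain ⟨A', UD, res⟩ := s'
    match res with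
    | some S' =>
      have h4 := Nat.mul_le_mul_right (d + 1) (Finset.card_le_card l4)
      simp only [val_ret, cost_ret] at l1 l3 h4 ⊢
      refine ⟨l1, by simp, ?_⟩
      rw [add_mul]
      omega
    | none =>
      obtain ⟨m1, m2⟩ := l2 rfl
      obtain ⟨i1, i2, i3⟩ := ih _ m1 rfl
      refine ⟨i1, fun hn => ?_, ?_⟩
      · have := i2 hn
        simp only at this m2
        rw [add_mul, add_mul]
        omega
      · simp only at i3 l3 ⊢
        rw [add_mul]
        omega

/-- Augment `S` until a breadth-first search with `k` layers fails. -/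
noncomputable def improve (k : ℕ) : ℕ → Finset (Fin n) → QTree n (Finset (Fin n))
  | 0, S => ret S
  | f + 1, S => (layers S (Nat.log 2 S.card + 1) k (∅, (∅, fun _ => (∅, ∅)), none)).bind fun o =>
      match o with
      | some S' => improve k f S'
      | none => ret S

/-- There are at most `|I| - |S|` successful searches and one failing search. The fuel `f` can only
run out when `S` is already optimal. -/
theorem improve_spec {M : Bool → Matroid (Fin n)} (hE : ∀ b, (M b).E = Set.univ) (k : ℕ)
    {I : Finset (Fin n)} (hI : ∀ b, (M b).Indep (I : Set (Fin n)))
    (hmax : ∀ J : Finset (Fin n), (∀ b, (M b).Indep (J : Set (Fin n))) → J.card ≤ I.card)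
    (f : ℕ) (S : Finset (Fin n)) (hS : ∀ b, (M b).Indep (S : Set (Fin n)))
    (hf : I.card ≤ S.card + f) :
    (∀ b, (M b).Indep (((improve k f S).val M : Finset (Fin n)) : Set (Fin n))) ∧
    k * I.card ≤ (k + 1) * ((improve k f S).val M).card ∧
    (improve k f S).cost M ≤ (I.card + 1 - S.card) *
      (k * (n * (Nat.log 2 I.card + 5)) + n * (Nat.log 2 I.card + 2)) := by
  induction f generalizing S with
  | zero =>
    simp only [improve, val_ret, cost_ret]
    refine ⟨hS, ?_, by omega⟩
    nlinarith
  | succ f ih =>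
    have hSI := hmax S hS
    obtain ⟨l1, l2, l3⟩ := layers_spec hE hS (d := Nat.log 2 S.card + 1)
      (Nat.lt_pow_succ_log_self (by norm_num) _).le hI k (∅, (∅, fun _ => (∅, ∅)), none)
      ⟨by simp, by simp, by simp, by simp, by simp⟩ rfl
    have hlog : Nat.log 2 S.card ≤ Nat.log 2 I.card := Nat.log_mono_right hSI
    have hcost : (layers S (Nat.log 2 S.card + 1) k (∅, (∅, fun _ => (∅, ∅)), none)).cost M ≤
        k * (n * (Nat.log 2 I.card + 5)) + n * (Nat.log 2 I.card + 2) := by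
      have h1 : S.card ≤ n := by simpa using Finset.card_le_univ S
      have h2 : S.card * (Nat.log 2 S.card + 1 + 1) ≤ n * (Nat.log 2 I.card + 2) :=
        Nat.mul_le_mul h1 (by omega)
      have h3 : k * (n * (Nat.log 2 S.card + 1 + 4)) ≤ k * (n * (Nat.log 2 I.card + 5)) :=
        Nat.mul_le_mul_left _ (Nat.mul_le_mul_left _ (by omega))
      omega
    generalize k * (n * (Nat.log 2 I.card + 5)) + n * (Nat.log 2 I.card + 2) = C at hcost ih ⊢
    simp only [improve, val_bind, cost_bind]
    generalize (layers S (Nat.log 2 S.card + 1) k (∅, (∅, fun _ => (∅, ∅)), none)).cost M = c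
      at hcost ⊢
    clear l3
    generalize (layers S (Nat.log 2 S.card + 1) k (∅, (∅, fun _ => (∅, ∅)), none)).val M = o
      at l1 l2 ⊢
    match o with
    | some S' =>
      have ha := l1 S' rfl
      obtain ⟨i1, i2, i3⟩ := ih S' ha.indep (by rw [ha.card]; omega)
      refine ⟨i1, i2, ?_⟩
      have hle := hmax S' ha.indep
      rw [ha.card] at hle i3
      obtain ⟨x, hx⟩ : ∃ x, I.card + 1 - S.card = x + 1 := ⟨I.card - S.card, by omega⟩
      rw [show I.card + 1 - (S.card + 1) = x by omega] at i3
      rw [hx, add_mul]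
      simp only
      omega
    | none =>
      simp only [val_ret, cost_ret]
      refine ⟨hS, ?_, ?_⟩
      · have := l2 rfl
        simp only [Finset.card_empty] at this
        rw [add_mul]
        omega
      · obtain ⟨x, hx⟩ : ∃ x, I.card + 1 - S.card = x + 1 := ⟨I.card - S.card, by omega⟩
        rw [hx, add_mul]
        have := Nat.zero_le (x * C)
        omega

end Augment

/-! ### Balancing the two strategies. -/

open QTree Auction Augment

/-- A strategy for matroid intersection with accuracy `p / q`. -/
noncomputable def solve (n p q : ℕ) : QTree n (Finset (Fin n)) :=
  if q ≤ p then ret ∅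
  else (auction 3).bind fun S =>
    if S.card = 0 then ret ∅
    -- The number of levels or layers is about `2 / ε`; the threshold equalizes the costs of auction
    -- and augmentation.
    else if 2 * q / p + 1 ≤ Nat.sqrt (S.card * (Nat.log 2 S.card + 1)) + 1 then
      auction (2 * q / p + 1)
    else (auction (Nat.sqrt (S.card * (Nat.log 2 S.card + 1)) + 1)).bind
      (improve (2 * q / p + 1) n)

/-- An upper bound for the square of the number of queries times `ε / n`, up to a constant. -/
def queryBound (r : ℕ) : ℕ := max 1 (r * (Nat.log 2 r + 1))

/-- The hypothesis says `K * (r - s) ≤ r + s ≤ 2 * r`, and `2 / K` is at most `p / q`. -/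
theorem auction_accuracy {p q K r s : ℕ} (hK : 2 * q ≤ K * p) (h : K * r ≤ (K + 1) * s + r)
    (hs : s ≤ r) : q * r ≤ q * s + p * r := by
  obtain ⟨d, rfl⟩ := Nat.exists_eq_add_of_le hs
  have h1 : K * d ≤ 2 * s + d := by nlinarith
  have h2 : K * d ≤ 2 * (s + d) := by omega
  have h3 : 2 * (q * d) ≤ 2 * (p * (s + d)) := by
    calc 2 * (q * d) = (2 * q) * d := by ring
      _ ≤ K * p * d := Nat.mul_le_mul_right _ hK
      _ = p * (K * d) := by ring
      _ ≤ p * (2 * (s + d)) := Nat.mul_le_mul_left _ h2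
      _ = _ := by ring
  rw [mul_add]
  omega

theorem solve_spec {n p q : ℕ} (hp : 0 < p) {M : Bool → Matroid (Fin n)}
    (hE : ∀ b, (M b).E = Set.univ) {I : Finset (Fin n)} (hI : ∀ b, (M b).Indep (I : Set (Fin n)))
    (hmax : ∀ J : Finset (Fin n), (∀ b, (M b).Indep (J : Set (Fin n))) → J.card ≤ I.card) :
    (∀ b, (M b).Indep (((solve n p q).val M : Finset (Fin n)) : Set (Fin n))) ∧
    q * I.card ≤ q * ((solve n p q).val M).card + p * I.card ∧
    ((solve n p q).cost M * p) ^ 2 ≤ (363 * n * q) ^ 2 * queryBound I.card := by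
  have hmax' : ∀ J : Finset (Fin n), (M false).Indep (J : Set (Fin n)) →
      (M true).Indep (J : Set (Fin n)) → J.card ≤ I.card :=
    fun J h1 h2 => hmax J (by rintro (_ | _) <;> assumption)
  unfold solve
  split_ifs with hpq
  · refine ⟨by simp, ?_, by simp⟩
    have := Nat.mul_le_mul_right I.card hpq
    omega
  have hpq : p < q := by omega
  simp only [val_bind, cost_bind]
  obtain ⟨a1, a2, a3, a4⟩ := auction_spec hE (k := 3) (by norm_num) (hI false) (hI true) hmax'
  generalize (auction 3).val M = S at a1 a2 a3 a4 ⊢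
  generalize (auction 3).cost M = c₀ at a4 ⊢
  have hSI := hmax' S a1 a2
  have ha4 : c₀ * p ≤ 72 * n * q := by
    calc c₀ * p ≤ (8 * 3 ^ 2 * n) * q := Nat.mul_le_mul a4 hpq.le
      _ = _ := by ring
  split_ifs with hS0 hK
  -- The guarantee of the coarse auction is `3 * r ≤ 4 * |S| + r`, so `|S| = 0` forces `r = 0`, and
  -- in general `r ≤ 2 * |S|`.
  · have hI0 : I.card = 0 := by omega
    simp only [val_ret, cost_ret, hI0]
    refine ⟨by simp, by simp, ?_⟩
    simp only [queryBound, zero_mul, add_zero]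
    rw [max_eq_left (by norm_num), mul_one]
    gcongr
    nlinarith
  all_goals
    set s := S.card with hs
    set m := s * (Nat.log 2 s + 1) with hm
    set x := Nat.sqrt m with hx
    set K := 2 * q / p + 1 with hKdef
    have hs1 : 1 ≤ s := by omega
    have hm1 : 1 ≤ m := Nat.mul_pos hs1 (by omega)
    have hx1 : 1 ≤ x := Nat.le_sqrt.2 (by simpa using hm1)
    have hxm : x * x ≤ m := Nat.sqrt_le m
    have hmx : m < (x + 1) * (x + 1) := Nat.lt_succ_sqrt m
    have hK1 : 2 * q ≤ K * p := by
      have := Nat.lt_div_mul_add (a := 2 * q) hp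
      rw [hKdef, add_mul]
      omega
    have hK2 : K * p ≤ 3 * q := by
      have := Nat.div_mul_le_self (2 * q) p
      rw [hKdef, add_mul]
      omega
    have hmW : x ^ 2 ≤ queryBound I.card := by
      rw [pow_two]
      refine hxm.trans (le_max_of_le_right ?_)
      exact Nat.mul_le_mul hSI (Nat.add_le_add_right (Nat.log_mono_right hSI) 1)
    have fin : ∀ c, c * p ≤ 363 * n * q * x →
        (c * p) ^ 2 ≤ (363 * n * q) ^ 2 * queryBound I.card := by
      intro c hc
      calc (c * p) ^ 2 ≤ (363 * n * q * x) ^ 2 := Nat.pow_le_pow_left hc 2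
        _ = (363 * n * q) ^ 2 * x ^ 2 := by ring
        _ ≤ _ := Nat.mul_le_mul_left _ hmW
    have hnq : n * q ≤ n * q * x := Nat.le_mul_of_pos_right _ hx1
  · obtain ⟨b1, b2, b3, b4⟩ := auction_spec hE (k := K) (Nat.succ_pos _) (hI false) (hI true) hmax'
    refine ⟨by rintro (_ | _) <;> assumption, auction_accuracy hK1 b3 (hmax' _ b1 b2),
      fin _ ?_⟩
    have h1 : (auction K).cost M * p ≤ 48 * (n * q * x) := by
      calc (auction K).cost M * p ≤ 8 * K ^ 2 * n * p := Nat.mul_le_mul_right _ b4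
        _ = 8 * n * K * (K * p) := by ring
        _ ≤ 8 * n * (2 * x) * (3 * q) := by gcongr; omega
        _ = _ := by ring
    rw [add_mul]
    calc c₀ * p + (auction K).cost M * p ≤ 72 * (n * q * x) + 48 * (n * q * x) := by
          refine add_le_add (ha4.trans ?_) h1
          rw [mul_assoc]
          exact Nat.mul_le_mul_left _ hnq
      _ ≤ 363 * (n * q * x) := by omega
      _ = _ := by ring
  · simp only [val_bind, cost_bind]
    obtain ⟨b1, b2, b3, b4⟩ := auction_spec hE (k := x + 1) (by omega) (hI false) (hI true) hmax'
    generalize (auction (x + 1)).val M = S₁ at b1 b2 b3 b4 ⊢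
    generalize (auction (x + 1)).cost M = c₁ at b4 ⊢
    have hS1 := hmax' S₁ b1 b2
    obtain ⟨i1, i2, i3⟩ := improve_spec hE K hI hmax n S₁ (by rintro (_ | _) <;> assumption) (by
      have : I.card ≤ n := by simpa using Finset.card_le_univ I
      omega)
    generalize (improve K n S₁).val M = S₂ at i1 i2 ⊢
    generalize (improve K n S₁).cost M = c₂ at i3 ⊢
    refine ⟨i1, auction_accuracy hK1 (by omega) (hmax _ i1), fin _ ?_⟩
    set lam := Nat.log 2 s + 1 with hlam
    have hlogr : Nat.log 2 I.card ≤ lam := by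
      have : Nat.log 2 I.card ≤ Nat.log 2 (s * 2) := Nat.log_mono_right (by omega)
      rwa [Nat.log_mul_base (by norm_num) (by omega)] at this
    have hlams : lam ≤ s := by
      have := Nat.log_lt_self 2 (x := s) (by omega)
      omega
    have hlamx : lam ≤ x := by
      by_contra hcon
      have h1 : (x + 1) * (x + 1) ≤ lam * lam := Nat.mul_le_mul (by omega) (by omega)
      have h2 : lam * lam ≤ s * lam := Nat.mul_le_mul_right _ hlams
      omega
    -- The deficit `d` left by the auction satisfies `(x + 1) * d ≤ 4 * s`, while `s * lam = m < (x
    -- + 1) ^ 2`; divide by `x + 1`.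
    have hdef : (I.card - S₁.card) * lam ≤ 8 * x := by
      obtain ⟨d, hd⟩ := Nat.exists_eq_add_of_le hS1
      rw [hd] at b3 ⊢
      rw [Nat.add_sub_cancel_left]
      have h1 : (x + 1) * d ≤ 4 * s := by
        have : (x + 1) * d ≤ 2 * S₁.card + d := by nlinarith
        omega
      have h2 : (x + 1) * (d * lam) ≤ (x + 1) * (4 * (x + 1)) := by
        calc (x + 1) * (d * lam) = (x + 1) * d * lam := by ring
          _ ≤ 4 * s * lam := Nat.mul_le_mul_right _ h1
          _ = 4 * m := by rw [hm]; ring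
          _ ≤ 4 * ((x + 1) * (x + 1)) := by omega
          _ = _ := by ring
      have := Nat.le_of_mul_le_mul_left h2 (by omega)
      omega
    have hc2 : c₂ ≤ 81 * K * n * x := by
      have h1 : (I.card + 1 - S₁.card) * lam ≤ 9 * x := by
        rw [show I.card + 1 - S₁.card = (I.card - S₁.card) + 1 by omega, add_mul]
        omega
      have hK0 : 1 ≤ K := by omega
      have h2 : K * (n * (Nat.log 2 I.card + 5)) + n * (Nat.log 2 I.card + 2) ≤
          K * n * (9 * lam) := by
        calc _ ≤ K * (n * (Nat.log 2 I.card + 5)) + K * (n * (Nat.log 2 I.card + 2)) :=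
              add_le_add le_rfl (Nat.le_mul_of_pos_left _ hK0)
          _ = K * n * (2 * Nat.log 2 I.card + 7) := by ring
          _ ≤ _ := Nat.mul_le_mul_left _ (by omega)
      calc c₂ ≤ _ := i3
        _ ≤ (I.card + 1 - S₁.card) * (K * n * (9 * lam)) := Nat.mul_le_mul_left _ h2
        _ = 9 * K * n * ((I.card + 1 - S₁.card) * lam) := by ring
        _ ≤ 9 * K * n * (9 * x) := Nat.mul_le_mul_left _ h1
        _ = _ := by ring
    have hc2p : c₂ * p ≤ 243 * (n * q * x) := by
      calc c₂ * p ≤ 81 * K * n * x * p := Nat.mul_le_mul_right _ hc2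
        _ = 81 * n * x * (K * p) := by ring
        _ ≤ 81 * n * x * (3 * q) := Nat.mul_le_mul_left _ hK2
        _ = _ := by ring
    have hc1p : c₁ * p ≤ 48 * (n * q * x) := by
      calc c₁ * p ≤ 8 * (x + 1) ^ 2 * n * p := Nat.mul_le_mul_right _ b4
        _ = 8 * n * (x + 1) * ((x + 1) * p) := by ring
        _ ≤ 8 * n * (2 * x) * (K * p) := by gcongr <;> omega
        _ ≤ 8 * n * (2 * x) * (3 * q) := Nat.mul_le_mul_left _ hK2
        _ = _ := by ring
    -- The constant is `363 = 72 + 48 + 243`: coarse auction, main auction, augmentations.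
    calc (c₀ + (c₁ + c₂)) * p = c₀ * p + (c₁ * p + c₂ * p) := by ring
      _ ≤ 72 * (n * q * x) + (48 * (n * q * x) + 243 * (n * q * x)) := by
          refine add_le_add (ha4.trans ?_) (add_le_add hc1p hc2p)
          rw [mul_assoc]
          exact Nat.mul_le_mul_left _ hnq
      _ = _ := by ring

/-- An action of an algorithm: a query or an output. -/
abbrev OracleAction : Type := (Bool × List ℕ) ⊕ List ℕ

/-! ### Verifying a query table is primitive recursive. -/

namespace SearchTable

open Encodable

/-- The action that a finite table prescribes after the answers `h`. -/
def act (T : List OracleAction) (h : List Bool) : OracleAction := T.getD (encode h) (Sum.inr [])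

/-- The binary digit of `m` at position `i` is one. -/
abbrev Bit (m i : ℕ) : Prop := m / 2 ^ i % 2 = 1

/-- The number of elements of the subset of `{0, …, n - 1}` with the characteristic number `c`. -/
def size (n c : ℕ) : ℕ := ((List.range n).filter fun i => Bit c i).length

/-- The subset with the characteristic number `c` is listed by `L`. -/
def Lists (n c : ℕ) (L : List ℕ) : Prop := ∀ i < n, (Bit c i ↔ i ∈ L)

/-- The family of sets with the characteristic number `m` is the family of the independent sets of
a matroid. -/
def IsMatroidCode (n m : ℕ) : Prop :=
  Bit m 0 ∧
  (∀ c < 2 ^ n, ∀ c' < 2 ^ n, (∀ i < n, ¬ Bit c i ∨ Bit c' i) → Bit m c' → Bit m c) ∧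
  (∀ c < 2 ^ n, ∀ c' < 2 ^ n, Bit m c ∧ Bit m c' ∧ size n c < size n c' →
    ∃ i < n, Bit c' i ∧ ¬ Bit c i ∧
      ∃ d < 2 ^ n, Bit m d ∧ ∀ j < n, (Bit d j ↔ (Bit c j ∨ j = i)))

/-- The family coded by `m` contains the set that `L` lists. -/
def Contains (n m : ℕ) (L : List ℕ) : Prop := ∃ c < 2 ^ n, Bit m c ∧ Lists n c L

open Classical in
/-- One step of the run of a table on the families coded by `m₁` and `m₂`. -/
noncomputable def step (n m₁ m₂ : ℕ) (T : List OracleAction) (h : List Bool) : List Bool :=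
  match act T h with
  | Sum.inl bL => decide (Contains n (if bL.1 then m₂ else m₁) bL.2) :: h
  | Sum.inr _ => h

/-- The list that an action returns. -/
def output : OracleAction → List ℕ := Sum.elim (fun _ => []) id

/-- The action is an output. -/
def isOutput : OracleAction → Bool := Sum.elim (fun _ => false) fun _ => true

/-- The output size `s` and the number `k` of queries are good enough if `r` is optimal. -/
def Meets (n p q r s k : ℕ) : Prop :=
  q * r ≤ q * s + p * r ∧
    ∃ L < n + 1, 2 ^ L ≤ max 1 r ∧ (k * p) ^ 2 ≤ (363 * n * q) ^ 2 * max 1 (r * (L + 1))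

/-- The final answers `h` of the run of a table are good. -/
def GoodEnd (n p q m₁ m₂ : ℕ) (T : List OracleAction) (h : List Bool) : Prop :=
  isOutput (act T h) = true ∧
  ∃ c < 2 ^ n, Bit m₁ c ∧ Bit m₂ c ∧ Lists n c (output (act T h)) ∧
    ∃ b < 2 ^ n, Bit m₁ b ∧ Bit m₂ b ∧
      (∀ c' < 2 ^ n, Bit m₁ c' ∧ Bit m₂ c' → size n c' ≤ size n b) ∧
      Meets n p q (size n b) (size n c) h.length

/-- The table `y.1`, run for `y.2` steps, is good for all matroids. -/
def Check (x : ℕ × ℕ × ℕ) (y : List OracleAction × ℕ) : Prop :=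
  ∀ m₁ < 2 ^ 2 ^ x.1, ∀ m₂ < 2 ^ 2 ^ x.1, IsMatroidCode x.1 m₁ ∧ IsMatroidCode x.1 m₂ →
    GoodEnd x.1 x.2.1 x.2.2 m₁ m₂ y.1 ((step x.1 m₁ m₂ y.1)^[y.2] [])

section Primrec

open Primrec

variable {α : Type} [Primcodable α]

/-- Sets and matroids are coded by numbers below `2 ^ n` and `2 ^ 2 ^ n`, so every quantifier in
`Check` is bounded and primitive recursiveness follows from its shape. -/
theorem primrecPred_forall_lt {f : α → ℕ} {R : α → ℕ → Prop} (hf : Primrec f)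
    (hR : PrimrecPred fun z : α × ℕ => R z.1 z.2) : PrimrecPred fun a => ∀ i < f a, R a i := by
  have h : PrimrecRel fun (i : ℕ) (a : α) => R a i := hR.comp (snd.pair fst)
  exact ((h.forall_mem_list.comp (list_range.comp hf) Primrec.id)).of_eq (by simp)

theorem primrecPred_exists_lt {f : α → ℕ} {R : α → ℕ → Prop} (hf : Primrec f)
    (hR : PrimrecPred fun z : α × ℕ => R z.1 z.2) : PrimrecPred fun a => ∃ i < f a, R a i := by
  have h : PrimrecRel fun (i : ℕ) (a : α) => R a i := hR.comp (snd.pair fst)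
  exact ((h.exists_mem_list.comp (list_range.comp hf) Primrec.id)).of_eq (by simp)

theorem primrecPred_imp {p q : α → Prop} (hp : PrimrecPred p) (hq : PrimrecPred q) :
    PrimrecPred fun a => p a → q a :=
  (hp.not.or hq).of_eq fun a => by tauto

theorem primrecPred_iff {p q : α → Prop} (hp : PrimrecPred p) (hq : PrimrecPred q) :
    PrimrecPred fun a => p a ↔ q a :=
  ((primrecPred_imp hp hq).and (primrecPred_imp hq hp)).of_eq fun a => by tauto

theorem primrec_pow {f g : α → ℕ} (hf : Primrec f) (hg : Primrec g) :
    Primrec fun a => f a ^ g a :=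
  (Primrec₂.unpaired'.1 Nat.Primrec.pow).comp hf hg

theorem primrec_two_pow {f : α → ℕ} (hf : Primrec f) : Primrec fun a => 2 ^ f a :=
  primrec_pow (const 2) hf

theorem primrecPred_bit {f g : α → ℕ} (hf : Primrec f) (hg : Primrec g) :
    PrimrecPred fun a => Bit (f a) (g a) :=
  Primrec.eq.comp (nat_mod.comp (nat_div.comp hf (primrec_two_pow hg)) (const 2)) (const 1)

theorem primrec_size {f g : α → ℕ} (hf : Primrec f) (hg : Primrec g) :
    Primrec fun a => size (f a) (g a) := by
  have h : PrimrecRel fun (i c : ℕ) => Bit c i := primrecPred_bit snd fst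
  exact list_length.comp (h.listFilter.comp (list_range.comp hf) hg)

theorem primrecPred_mem {f : α → ℕ} {g : α → List ℕ} (hf : Primrec f) (hg : Primrec g) :
    PrimrecPred fun a => f a ∈ g a := by
  have h : PrimrecRel fun (i j : ℕ) => i = j := Primrec.eq
  exact (h.exists_mem_list.comp hg hf).of_eq fun a => by simp

theorem primrecPred_lists {f g : α → ℕ} {L : α → List ℕ} (hf : Primrec f) (hg : Primrec g)
    (hL : Primrec L) : PrimrecPred fun a => Lists (f a) (g a) (L a) :=
  primrecPred_forall_lt hf (primrecPred_iff (primrecPred_bit (hg.comp fst) snd)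
    (primrecPred_mem snd (hL.comp fst)))

theorem primrecPred_contains {f g : α → ℕ} {L : α → List ℕ} (hf : Primrec f) (hg : Primrec g)
    (hL : Primrec L) : PrimrecPred fun a => Contains (f a) (g a) (L a) :=
  primrecPred_exists_lt (primrec_two_pow hf) ((primrecPred_bit (hg.comp fst) snd).and
    (primrecPred_lists (hf.comp fst) snd (hL.comp fst)))

theorem primrecPred_isMatroidCode {f g : α → ℕ} (hf : Primrec f) (hg : Primrec g) :
    PrimrecPred fun a => IsMatroidCode (f a) (g a) := by
  refine (primrecPred_bit hg (const 0)).and (PrimrecPred.and ?_ ?_)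
  · refine primrecPred_forall_lt (primrec_two_pow hf)
      (primrecPred_forall_lt (primrec_two_pow (hf.comp fst)) (primrecPred_imp
        (primrecPred_forall_lt (hf.comp (fst.comp fst)) ?_)
        (primrecPred_imp (primrecPred_bit (hg.comp (fst.comp fst)) snd)
          (primrecPred_bit (hg.comp (fst.comp fst)) (snd.comp fst)))))
    exact (primrecPred_bit (snd.comp (fst.comp fst)) snd).not.or
      (primrecPred_bit (snd.comp fst) snd)
  · refine primrecPred_forall_lt (primrec_two_pow hf)
      (primrecPred_forall_lt (primrec_two_pow (hf.comp fst)) (primrecPred_imp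
        ((primrecPred_bit (hg.comp (fst.comp fst)) (snd.comp fst)).and
          ((primrecPred_bit (hg.comp (fst.comp fst)) snd).and
            (nat_lt.comp (primrec_size (hf.comp (fst.comp fst)) (snd.comp fst))
              (primrec_size (hf.comp (fst.comp fst)) snd))))
        (primrecPred_exists_lt (hf.comp (fst.comp fst))
          ((primrecPred_bit (snd.comp fst) snd).and
            ((primrecPred_bit (snd.comp (fst.comp fst)) snd).not.and
              (primrecPred_exists_lt (primrec_two_pow (hf.comp (fst.comp (fst.comp fst))))
                ((primrecPred_bit (hg.comp (fst.comp (fst.comp (fst.comp fst)))) snd).and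
                  (primrecPred_forall_lt (hf.comp (fst.comp (fst.comp (fst.comp fst)))) ?_))))))))
    exact primrecPred_iff (primrecPred_bit (snd.comp fst) snd)
      ((primrecPred_bit (snd.comp (fst.comp (fst.comp (fst.comp fst)))) snd).or
        (Primrec.eq.comp snd (snd.comp (fst.comp fst))))

theorem primrec_act {T : α → List OracleAction} {h : α → List Bool} (hT : Primrec T)
    (hh : Primrec h) : Primrec fun a => act (T a) (h a) :=
  (list_getD (Sum.inr [] : OracleAction)).comp hT (Primrec.encode.comp hh)

theorem primrec_step {f g₁ g₂ : α → ℕ} {T : α → List OracleAction} {h : α → List Bool}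
    (hf : Primrec f) (hg₁ : Primrec g₁) (hg₂ : Primrec g₂) (hT : Primrec T) (hh : Primrec h) :
    Primrec fun a => step (f a) (g₁ a) (g₂ a) (T a) (h a) := by
  classical
  refine (Primrec.sumCasesOn (g := fun a (bL : Bool × List ℕ) =>
    decide (Contains (f a) (if bL.1 then g₂ a else g₁ a) bL.2) :: h a)
    (h := fun a _ => h a) (primrec_act hT hh) ?_ ?_).of_eq ?_
  · refine Primrec.list_cons.comp (PrimrecPred.decide (primrecPred_contains (hf.comp fst)
      (Primrec.ite (Primrec.eq.comp (fst.comp snd) (const true)) (hg₂.comp fst) (hg₁.comp fst))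
      (snd.comp snd))) (hh.comp fst)
  · exact hh.comp fst
  · intro a
    unfold step
    cases act (T a) (h a) <;> simp

theorem primrec_output {f : α → OracleAction} (hf : Primrec f) : Primrec fun a => output (f a) :=
  (Primrec.sumCasesOn (g := fun _ _ => ([] : List ℕ)) (h := fun _ L => L) hf (const []).to₂
    snd.to₂).of_eq fun a => by unfold output; cases f a <;> rfl

theorem primrec_isOutput {f : α → OracleAction} (hf : Primrec f) :
    Primrec fun a => isOutput (f a) :=
  (Primrec.sumCasesOn (g := fun _ _ => false) (h := fun _ _ => true) hf (const false).to₂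
    (const true).to₂).of_eq fun a => by unfold isOutput; cases f a <;> rfl

theorem primrecPred_meets {n p q r s k : α → ℕ} (hn : Primrec n) (hp : Primrec p)
    (hq : Primrec q) (hr : Primrec r) (hs : Primrec s) (hk : Primrec k) :
    PrimrecPred fun a => Meets (n a) (p a) (q a) (r a) (s a) (k a) := by
  refine (nat_le.comp (nat_mul.comp hq hr)
    (nat_add.comp (nat_mul.comp hq hs) (nat_mul.comp hp hr))).and
    (primrecPred_exists_lt (nat_add.comp hn (const 1)) ((nat_le.comp (primrec_two_pow snd)
      (nat_max.comp (const 1) (hr.comp fst))).and (nat_le.comp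
        (primrec_pow (nat_mul.comp (hk.comp fst) (hp.comp fst)) (const 2))
        (nat_mul.comp (primrec_pow (nat_mul.comp (nat_mul.comp (const 363) (hn.comp fst))
          (hq.comp fst)) (const 2)) (nat_max.comp (const 1)
            (nat_mul.comp (hr.comp fst) (nat_add.comp snd (const 1))))))))

theorem primrecPred_goodEnd {n p q m₁ m₂ : α → ℕ} {T : α → List OracleAction} {h : α → List Bool}
    (hn : Primrec n) (hp : Primrec p) (hq : Primrec q) (hm₁ : Primrec m₁) (hm₂ : Primrec m₂)
    (hT : Primrec T) (hh : Primrec h) :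
    PrimrecPred fun a => GoodEnd (n a) (p a) (q a) (m₁ a) (m₂ a) (T a) (h a) := by
  have ha := primrec_act hT hh
  refine (Primrec.eq.comp (primrec_isOutput ha) (const true)).and
    (primrecPred_exists_lt (primrec_two_pow hn) ((primrecPred_bit (hm₁.comp fst) snd).and
      ((primrecPred_bit (hm₂.comp fst) snd).and ((primrecPred_lists (hn.comp fst) snd
        (primrec_output (ha.comp fst))).and
        (primrecPred_exists_lt (primrec_two_pow (hn.comp fst))
          ((primrecPred_bit (hm₁.comp (fst.comp fst)) snd).and
          ((primrecPred_bit (hm₂.comp (fst.comp fst)) snd).and (PrimrecPred.and ?_ ?_))))))))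
  · exact primrecPred_forall_lt (primrec_two_pow (hn.comp (fst.comp fst)))
      (primrecPred_imp ((primrecPred_bit (hm₁.comp (fst.comp (fst.comp fst))) snd).and
        (primrecPred_bit (hm₂.comp (fst.comp (fst.comp fst))) snd))
        (nat_le.comp (primrec_size (hn.comp (fst.comp (fst.comp fst))) snd)
          (primrec_size (hn.comp (fst.comp (fst.comp fst))) (snd.comp fst))))
  · exact primrecPred_meets (hn.comp (fst.comp fst)) (hp.comp (fst.comp fst))
      (hq.comp (fst.comp fst)) (primrec_size (hn.comp (fst.comp fst)) snd)
      (primrec_size (hn.comp (fst.comp fst)) (snd.comp fst))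
      (list_length.comp (hh.comp (fst.comp fst)))

theorem primrecRel_check : PrimrecRel Check := by
  have hn : Primrec fun z : (((ℕ × ℕ × ℕ) × (List OracleAction × ℕ)) × ℕ) × ℕ => z.1.1.1.1 :=
    fst.comp (fst.comp (fst.comp fst))
  have hp : Primrec fun z : (((ℕ × ℕ × ℕ) × (List OracleAction × ℕ)) × ℕ) × ℕ => z.1.1.1.2.1 :=
    fst.comp (snd.comp (fst.comp (fst.comp fst)))
  have hq : Primrec fun z : (((ℕ × ℕ × ℕ) × (List OracleAction × ℕ)) × ℕ) × ℕ => z.1.1.1.2.2 :=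
    snd.comp (snd.comp (fst.comp (fst.comp fst)))
  have hT : Primrec fun z : (((ℕ × ℕ × ℕ) × (List OracleAction × ℕ)) × ℕ) × ℕ => z.1.1.2.1 :=
    fst.comp (snd.comp (fst.comp fst))
  have hN : Primrec fun z : (((ℕ × ℕ × ℕ) × (List OracleAction × ℕ)) × ℕ) × ℕ => z.1.1.2.2 :=
    snd.comp (snd.comp (fst.comp fst))
  have hm₁ : Primrec fun z : (((ℕ × ℕ × ℕ) × (List OracleAction × ℕ)) × ℕ) × ℕ => z.1.2 :=
    snd.comp fst
  refine primrecPred_forall_lt (primrec_two_pow (primrec_two_pow (fst.comp fst)))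
    (primrecPred_forall_lt (primrec_two_pow (primrec_two_pow (fst.comp (fst.comp fst))))
      (primrecPred_imp
        ((primrecPred_isMatroidCode hn hm₁).and (primrecPred_isMatroidCode hn snd)) ?_))
  refine primrecPred_goodEnd hn hp hq hm₁ snd hT (nat_iterate hN (const []) ?_)
  exact primrec_step (hn.comp fst) (hm₁.comp fst) (snd.comp fst) (hT.comp fst) snd

end Primrec

open Classical in
/-- Test whether `i` is the code of a good table. Inputs outside the intended domain pass the test
trivially. -/
noncomputable def test (x : ℕ × ℕ × ℕ) (i : ℕ) : Bool :=
  decide (x.2.1 * x.2.2 = 0) ||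
    (decode (α := List OracleAction × ℕ) i).elim false fun y => decide (Check x y)

theorem primrec_test : Primrec₂ test := by
  classical
  refine Primrec.or.comp (PrimrecPred.decide (Primrec.eq.comp (Primrec.nat_mul.comp
    (Primrec.fst.comp (Primrec.snd.comp Primrec.fst))
    (Primrec.snd.comp (Primrec.snd.comp Primrec.fst))) (Primrec.const 0))) ?_
  refine (Primrec.option_casesOn (o := fun z : (ℕ × ℕ × ℕ) × ℕ =>
    decode (α := List OracleAction × ℕ) z.2) (g := fun z y => decide (Check z.1 y))
    (Primrec.decode.comp Primrec.snd) (Primrec.const false) ?_).of_eq ?_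
  · exact PrimrecPred.decide (primrecRel_check.comp (Primrec.fst.comp Primrec.fst) Primrec.snd)
  · rintro ⟨x, i⟩
    cases decode (α := List OracleAction × ℕ) i <;> rfl

/-- The first code that passes the test. -/
noncomputable def find (H : ∀ x, ∃ i, test x i = true) (x : ℕ × ℕ × ℕ) : ℕ := Nat.find (H x)

theorem computable_find (H : ∀ x, ∃ i, test x i = true) : Computable (find H) := by
  refine (Partrec.rfind (p := fun x i => Part.some (test x i)) ?_).of_eq fun x => ?_
  · exact primrec_test.to_comp.partrec₂
  · refine Part.eq_some_iff.2 (Nat.mem_rfind.2 ⟨?_, fun {m} hm => ?_⟩)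
    · exact Part.mem_some_iff.2 (Nat.find_spec (H x)).symm
    · exact Part.mem_some_iff.2 (Bool.eq_false_iff.2 (Nat.find_min (H x) hm)).symm

/-- The table with a given code. -/
def tableOf (i : ℕ) : List OracleAction :=
  ((decode (α := List OracleAction × ℕ) i).getD ([], 0)).1

/-- On input `(n, p, q)`, search for the first table that passes the exhaustive check against all
pairs of matroids on `{0, …, n - 1}`, and follow it. The search asks no queries; it terminates
because the strategy `solve n p q` can be written as such a table. -/
noncomputable def algorithm (H : ∀ x, ∃ i, test x i = true) : OracleAlgorithm where
  next z := act (tableOf (find H z.1)) z.2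
  computable_next := by
    have h1 : Primrec tableOf := Primrec.fst.comp
      (Primrec.option_getD.comp (Primrec.decode) (Primrec.const ([], 0)))
    have h2 : Primrec₂ act := primrec_act Primrec.fst Primrec.snd
    exact h2.to_comp.comp (h1.to_comp.comp ((computable_find H).comp Computable.fst))
      Computable.snd

end SearchTable

/-! ### Codes represent matroids, and tables represent decision trees. -/

namespace SearchTable

open Encodable QTree

/-- The subset of `Fin n` with the characteristic number `c`. -/
def setOf (n c : ℕ) : Finset (Fin n) := Finset.univ.filter fun i => Bit c i

theorem bit_iff_testBit (m i : ℕ) : Bit m i ↔ m.testBit i = true := by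
  rw [Nat.testBit_eq_decide_div_mod_eq, decide_eq_true_iff]

theorem exists_code (N : ℕ) (P : ℕ → Prop) : ∃ m < 2 ^ N, ∀ i < N, Bit m i ↔ P i := by
  classical
  refine ⟨Nat.ofBits fun i : Fin N => decide (P i), Nat.ofBits_lt_two_pow _, fun i hi => ?_⟩
  rw [bit_iff_testBit, Nat.testBit_ofBits_lt _ _ hi, decide_eq_true_iff]

theorem mem_setOf {n c : ℕ} {i : Fin n} : i ∈ setOf n c ↔ Bit c i := by simp [setOf]

theorem exists_setOf_eq {n : ℕ} (X : Finset (Fin n)) : ∃ c < 2 ^ n, setOf n c = X := by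
  obtain ⟨c, hc, h⟩ := exists_code n fun i => ∃ hi : i < n, (⟨i, hi⟩ : Fin n) ∈ X
  refine ⟨c, hc, ?_⟩
  ext i
  rw [mem_setOf, h i i.2]
  simp

theorem size_eq (n c : ℕ) : size n c = (setOf n c).card := by
  have h : (((Finset.univ : Finset (Fin n)).filter fun i : Fin n => Bit c i).map Fin.valEmbedding) =
      ((List.range n).filter fun i => Bit c i).toFinset := by
    ext i
    simp only [Finset.mem_map, Finset.mem_filter, Finset.mem_univ, true_and, Fin.valEmbedding_apply,
      List.mem_toFinset, List.mem_filter, List.mem_range, decide_eq_true_eq]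
    constructor
    · rintro ⟨j, hj, rfl⟩
      exact ⟨j.2, hj⟩
    · rintro ⟨hi, hb⟩
      exact ⟨⟨i, hi⟩, hb, rfl⟩
  rw [size, setOf, ← Finset.card_map Fin.valEmbedding, h,
    List.toFinset_card_of_nodup (List.nodup_range.filter _)]

theorem lists_iff {n c : ℕ} {L : List ℕ} : Lists n c L ↔ setOf n c = listedSet n L := by
  constructor
  · intro h
    ext i
    rw [mem_setOf, h i i.2]
    simp [listedSet]
  · intro h i hi
    have := Finset.ext_iff.1 h ⟨i, hi⟩
    rw [mem_setOf] at this
    simpa [listedSet] using this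

/-- `m` is the characteristic number of the family of independent sets. -/
def Codes {n : ℕ} (m : ℕ) (M : Matroid (Fin n)) : Prop :=
  ∀ c < 2 ^ n, Bit m c ↔ M.Indep (setOf n c : Set (Fin n))

theorem Codes.contains_iff {n m : ℕ} {M : Matroid (Fin n)} (h : Codes m M) (L : List ℕ) :
    Contains n m L ↔ M.Indep (listedSet n L : Set (Fin n)) := by
  constructor
  · rintro ⟨c, hc, hb, hl⟩
    rw [← lists_iff.1 hl]
    exact (h c hc).1 hb
  · intro hi
    obtain ⟨c, hc, he⟩ := exists_setOf_eq (listedSet n L)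
    refine ⟨c, hc, (h c hc).2 ?_, lists_iff.2 he⟩
    rwa [he]

theorem exists_codes {n : ℕ} (M : Matroid (Fin n)) : ∃ m < 2 ^ 2 ^ n, Codes m M := by
  obtain ⟨m, hm, h⟩ := exists_code (2 ^ n) fun c => M.Indep (setOf n c : Set (Fin n))
  exact ⟨m, hm, h⟩

theorem setOf_zero (n : ℕ) : setOf n 0 = ∅ := by
  ext i
  simp [mem_setOf]

theorem forall_bit_iff_insert {n c d i : ℕ} (hi : i < n) :
    (∀ j < n, (Bit d j ↔ (Bit c j ∨ j = i))) ↔ setOf n d = insert ⟨i, hi⟩ (setOf n c) := by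
  rw [Finset.ext_iff]
  simp only [Finset.mem_insert, mem_setOf, Fin.ext_iff]
  constructor
  · intro h j
    rw [h j j.2]
    tauto
  · intro h j hj
    rw [h ⟨j, hj⟩]
    tauto

theorem forall_bit_imp_iff_subset {n c c' : ℕ} :
    (∀ i < n, ¬ Bit c i ∨ Bit c' i) ↔ setOf n c ⊆ setOf n c' := by
  constructor
  · intro h i hi
    rw [mem_setOf] at *
    exact (h i i.2).resolve_left (not_not.2 hi)
  · intro h i hi
    have := @h ⟨i, hi⟩
    rw [mem_setOf, mem_setOf] at this
    tauto

/-- For the augmentation axiom: if no element of the larger set could be added, the smaller set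
would span it. -/
theorem Codes.isMatroidCode {n m : ℕ} {M : Matroid (Fin n)} (hE : M.E = Set.univ)
    (h : Codes m M) : IsMatroidCode n m := by
  refine ⟨?_, ?_, ?_⟩
  · rw [h 0 (by positivity), setOf_zero]
    simp
  · intro c hc c' hc' hs
    rw [h c hc, h c' hc']
    rw [forall_bit_imp_iff_subset] at hs
    exact fun hi => hi.subset (Finset.coe_subset.2 hs)
  · rintro c hc c' hc' ⟨h1, h2, h3⟩
    rw [h c hc] at h1
    rw [h c' hc'] at h2
    rw [size_eq, size_eq] at h3
    by_contra hcon
    refine absurd (card_le_card_of_span h2 (Y := setOf n c) fun x hx => ?_) (by omega)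
    by_cases hxc : x ∈ setOf n c
    · exact mem_closure_of_mem hE hxc
    refine mem_closure_of_not_indep_insert hE h1 fun hi => hcon ?_
    obtain ⟨d, hd, hde⟩ := exists_setOf_eq (insert x (setOf n c))
    refine ⟨x, x.2, mem_setOf.1 hx, fun hb => hxc (mem_setOf.2 hb), d, hd, ?_, ?_⟩
    · rw [h d hd, hde]
      exact hi
    · rw [forall_bit_iff_insert x.2]
      exact hde

theorem IsMatroidCode.exists_matroid {n m : ℕ} (h : IsMatroidCode n m) :
    ∃ M : Matroid (Fin n), M.E = Set.univ ∧ Codes m M := by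
  obtain ⟨h1, h2, h3⟩ := h
  have hz : (0 : ℕ) < 2 ^ n := by positivity
  have congr : ∀ c < 2 ^ n, ∀ c' < 2 ^ n, setOf n c = setOf n c' → Bit m c' → Bit m c :=
    fun c hc c' hc' he => h2 c hc c' hc' (forall_bit_imp_iff_subset.2 he.subset)
  obtain ⟨N, hN, hNi⟩ : ∃ N : IndepMatroid (Fin n), N.E = Set.univ ∧ ∀ X : Finset (Fin n),
      N.Indep X ↔ ∃ c < 2 ^ n, setOf n c = X ∧ Bit m c :=
    ⟨IndepMatroid.ofFinset (Set.univ : Set (Fin n))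
    (fun X => ∃ c < 2 ^ n, setOf n c = X ∧ Bit m c)
    ⟨0, hz, setOf_zero n, h1⟩
    (by
      rintro I J ⟨c', hc', rfl, hb⟩ hIJ
      obtain ⟨c, hc, rfl⟩ := exists_setOf_eq I
      exact ⟨c, hc, rfl, h2 c hc c' hc' (forall_bit_imp_iff_subset.2 hIJ) hb⟩)
    (by
      rintro I J ⟨c, hc, rfl, hb⟩ ⟨c', hc', rfl, hb'⟩ hlt
      rw [← size_eq, ← size_eq] at hlt
      obtain ⟨i, hi, hi', hic, d, hd, hbd, hins⟩ := h3 c hc c' hc' ⟨hb, hb', hlt⟩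
      exact ⟨⟨i, hi⟩, mem_setOf.2 hi', fun hm => hic (mem_setOf.1 hm), d, hd,
        (forall_bit_iff_insert hi).1 hins, hbd⟩)
    (by simp), rfl, fun X => IndepMatroid.ofFinset_indep ..⟩
  refine ⟨N.matroid, hN, fun c hc => ?_⟩
  rw [IndepMatroid.matroid_indep_iff, hNi]
  constructor
  · exact fun hb => ⟨c, hc, rfl, hb⟩
  · rintro ⟨d, hd, he, hb⟩
    exact congr c hc d hd he.symm hb

/-- A run of a table is a run of every algorithm that follows the table. -/
theorem runsTo_of_isOutput {A : OracleAlgorithm} {n p q m₁ m₂ : ℕ} {M₁ M₂ : Matroid (Fin n)}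
    (h₁ : Codes m₁ M₁) (h₂ : Codes m₂ M₂) {T : List OracleAction}
    (hA : ∀ h, A.next ((n, p, q), h) = act T h) (N : ℕ) (h : List Bool)
    (hout : isOutput (act T ((step n m₁ m₂ T)^[N] h)) = true) :
    ∃ k, ((step n m₁ m₂ T)^[N] h).length = h.length + k ∧
      A.RunsTo p q M₁ M₂ h k (listedSet n (output (act T ((step n m₁ m₂ T)^[N] h)))) := by
  classical
  induction N generalizing h with
  | zero =>
    refine ⟨0, rfl, ?_⟩
    simp only [Function.iterate_zero, id] at hout ⊢
    refine .output h _ ?_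
    rw [hA]
    cases hact : act T h with
    | inl b => rw [hact] at hout; simp [isOutput] at hout
    | inr L => rfl
  | succ N ih =>
    rw [Function.iterate_succ_apply] at hout ⊢
    cases hact : act T h with
    | inr L =>
      have hs : step n m₁ m₂ T h = h := by simp [step, hact]
      rw [hs] at hout ⊢
      exact ih h hout
    | inl bL =>
      obtain ⟨b, L⟩ := bL
      have hs : step n m₁ m₂ T h =
          decide (Contains n (if b then m₂ else m₁) L) :: h := by simp [step, hact]
      rw [hs] at hout ⊢
      obtain ⟨k, hk, hr⟩ := ih _ hout
      refine ⟨k + 1, by rw [hk, List.length_cons]; omega, ?_⟩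
      cases b
      · refine .query₁ h L _ k _ (by rw [hA, hact]) ?_ hr
        simp only [Bool.false_eq_true, if_false, decide_eq_true_eq]
        exact h₁.contains_iff L
      · refine .query₂ h L _ k _ (by rw [hA, hact]) ?_ hr
        simp only [if_true, decide_eq_true_eq]
        exact h₂.contains_iff L

/-- A list of the elements of a set. -/
noncomputable def toL {n : ℕ} (X : Finset (Fin n)) : List ℕ := X.toList.map Fin.val

theorem listedSet_toL {n : ℕ} (X : Finset (Fin n)) : listedSet n (toL X) = X := by
  ext i
  simp [listedSet, toL, Fin.val_inj]

/-- The action of a decision tree after some answers, the first answer first. -/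
noncomputable def follow {n : ℕ} : QTree n (Finset (Fin n)) → List Bool → OracleAction
  | ret S, _ => Sum.inr (toL S)
  | ask b X _, [] => Sum.inl (b, toL X)
  | ask _ _ k, a :: as => follow (k a) as

/-- The height of a decision tree. -/
def height {n : ℕ} {α : Type} : QTree n α → ℕ
  | ret _ => 0
  | ask _ _ k => max (height (k false)) (height (k true)) + 1

/-- Only finitely many answer lists are as short as the height of the tree, so their codes are
bounded. The reversal is needed because histories store the latest answer first. -/
theorem exists_table {n : ℕ} (t : QTree n (Finset (Fin n))) :
    ∃ T, ∀ h : List Bool, h.length ≤ height t → act T h = follow t h.reverse := by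
  obtain ⟨B, hB⟩ := ((List.finite_length_le Bool (height t)).image
    (encode : List Bool → ℕ)).bddAbove
  refine ⟨(List.range (B + 1)).map fun i =>
    (decode (α := List Bool) i).elim (Sum.inr []) fun h => follow t h.reverse, fun h hh => ?_⟩
  have hlt : encode h < B + 1 := Nat.lt_succ_of_le (hB ⟨h, hh, rfl⟩)
  rw [act, List.getD_eq_getElem _ _ (by simpa using hlt)]
  simp

/-- Here `t'` is the subtree of `t` reached by the answers `h`. Surplus steps are harmless because
an output is a fixed point of `step`. -/
theorem iterate_step_of_follow {n m₁ m₂ : ℕ} {M : Bool → Matroid (Fin n)}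
    (h₁ : Codes m₁ (M false)) (h₂ : Codes m₂ (M true)) {T : List OracleAction} {D : ℕ}
    {t : QTree n (Finset (Fin n))}
    (hT : ∀ h : List Bool, h.length ≤ D → act T h = follow t h.reverse)
    (t' : QTree n (Finset (Fin n))) (h : List Bool)
    (ht' : ∀ as, follow t (h.reverse ++ as) = follow t' as) (N : ℕ) (hN : height t' ≤ N)
    (hD : h.length + height t' ≤ D) :
    act T ((step n m₁ m₂ T)^[N] h) = Sum.inr (toL (t'.val M)) ∧
      ((step n m₁ m₂ T)^[N] h).length = h.length + t'.cost M := by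
  classical
  induction t' generalizing h N with
  | ret S =>
    have hact : act T h = Sum.inr (toL S) := by
      rw [hT h (by omega)]
      simpa [follow] using ht' []
    have hfix : ∀ N, (step n m₁ m₂ T)^[N] h = h := fun N =>
      Function.iterate_fixed (by simp [step, hact]) N
    rw [hfix]
    exact ⟨hact, rfl⟩
  | ask b X k ih =>
    have hact : act T h = Sum.inl (b, toL X) := by
      rw [hT h (by omega)]
      simpa [follow] using ht' []
    obtain ⟨N, rfl⟩ : ∃ N', N = N' + 1 := ⟨N - 1, by simp only [height] at hN; omega⟩
    have hs : step n m₁ m₂ T h = decide ((M b).Indep (X : Set (Fin n))) :: h := by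
      simp only [step, hact]
      congr 2
      cases b
      · simp [h₁.contains_iff, listedSet_toL]
      · simp [h₂.contains_iff, listedSet_toL]
    rw [Function.iterate_succ_apply, hs]
    set a := decide ((M b).Indep (X : Set (Fin n))) with ha
    have hh : height (k a) ≤ max (height (k false)) (height (k true)) := by
      cases a
      · exact le_max_left _ _
      · exact le_max_right _ _
    simp only [height] at hN hD
    obtain ⟨i1, i2⟩ := ih a (a :: h) (fun as => by
      have := ht' (a :: as)
      simpa [follow] using this) N (by omega) (by rw [List.length_cons]; omega)
    refine ⟨i1, ?_⟩
    rw [i2, List.length_cons]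
    simp only [cost, ← ha]
    omega

end SearchTable

-- The table of `solve`, run for the height of its tree, passes the check: every pair of accepted
-- codes comes from actual matroids, to which `solve_spec` applies.
open SearchTable QTree in
theorem exists_test_eq_true (x : ℕ × ℕ × ℕ) : ∃ i, test x i = true := by
  classical
  obtain ⟨n, p, q⟩ := x
  by_cases hpq : p * q = 0
  · exact ⟨0, by simp [test, hpq]⟩
  have hp : 0 < p := Nat.pos_of_ne_zero (left_ne_zero_of_mul hpq)
  obtain ⟨T, hT⟩ := exists_table (solve n p q)
  refine ⟨Encodable.encode (T, height (solve n p q)), ?_⟩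
  rw [test, Encodable.encodek, Option.elim_some, Bool.or_eq_true, decide_eq_true_iff,
    decide_eq_true_iff]
  right
  rintro m₁ - m₂ - ⟨hm₁, hm₂⟩
  obtain ⟨M₁, hE₁, hc₁⟩ := hm₁.exists_matroid
  obtain ⟨M₂, hE₂, hc₂⟩ := hm₂.exists_matroid
  let M : Bool → Matroid (Fin n) := fun b => if b then M₂ else M₁
  have hE : ∀ b, (M b).E = Set.univ := by rintro (_ | _) <;> assumption
  obtain ⟨I, hI, hmax⟩ := Finset.exists_max_image
    (Finset.univ.filter fun J : Finset (Fin n) => ∀ b, (M b).Indep (J : Set (Fin n)))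
    Finset.card ⟨∅, by simp⟩
  simp only [Finset.mem_filter, Finset.mem_univ, true_and] at hI hmax
  obtain ⟨s1, s2, s3⟩ := solve_spec (p := p) (q := q) hp hE hI hmax
  obtain ⟨r1, r2⟩ := iterate_step_of_follow (M := M) hc₁ hc₂ hT (solve n p q) []
    (fun as => by simp) _ le_rfl (by simp)
  simp only at r1 r2 ⊢
  refine ⟨by rw [r1]; rfl, ?_⟩
  obtain ⟨c, hc, hcS⟩ := exists_setOf_eq ((solve n p q).val M)
  obtain ⟨b, hb, hbI⟩ := exists_setOf_eq I
  refine ⟨c, hc, (hc₁ c hc).2 (hcS ▸ s1 false), (hc₂ c hc).2 (hcS ▸ s1 true), ?_, b, hb,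
    (hc₁ b hb).2 (hbI ▸ hI false), (hc₂ b hb).2 (hbI ▸ hI true), ?_, ?_⟩
  · rw [r1, lists_iff, hcS]
    exact (listedSet_toL _).symm
  · rintro c' hc' ⟨k1, k2⟩
    rw [size_eq, size_eq, hbI]
    refine hmax _ ?_
    rintro (_ | _)
    · exact (hc₁ c' hc').1 k1
    · exact (hc₂ c' hc').1 k2
  · rw [size_eq, size_eq, hbI, hcS, r2, List.length_nil, zero_add]
    refine ⟨s2, Nat.log 2 I.card, ?_, ?_, s3⟩
    · have h1 := Nat.log_le_self 2 I.card
      have h2 : I.card ≤ n := by simpa using Finset.card_le_univ I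
      omega
    · rcases Nat.eq_zero_or_pos I.card with h | h
      · simp [h]
      · exact le_max_of_le_right (Nat.pow_log_le_self 2 h.ne')

/-! ### Real-valued bounds and the final theorem. -/

/-- The bound on the number of queries, in terms of real square roots and logarithms. -/
theorem queries_le {n p q r k L : ℕ} (hp : 0 < p) (hq : 0 < q) (hL : 2 ^ L ≤ max 1 r)
    (h : (k * p) ^ 2 ≤ (363 * n * q) ^ 2 * max 1 (r * (L + 1))) :
    (k : ℝ) ≤ 726 * ((n : ℝ) * Real.sqrt (max 1 ((r : ℝ) * Real.log (r : ℝ))) /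
      ((p : ℝ) / (q : ℝ))) := by
  have hp' : (0 : ℝ) < p := by exact_mod_cast hp
  have hq' : (0 : ℝ) < q := by exact_mod_cast hq
  set w : ℝ := max 1 ((r : ℝ) * Real.log r) with hw
  have hw1 : 1 ≤ w := le_max_left _ _
  have hle : ((max 1 (r * (L + 1)) : ℕ) : ℝ) ≤ 4 * w := by
    rcases Nat.lt_or_ge r 2 with hr | hr
    · have hL0 : L = 0 := by
        rw [max_eq_left (by omega)] at hL
        by_contra h0
        have := Nat.one_lt_two_pow h0
        omega
      have : max 1 (r * (L + 1)) = 1 := by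
        rw [hL0]
        omega
      rw [this]
      push_cast
      linarith
    · rw [max_eq_right (by omega)] at hL
      have hr' : (2 : ℝ) ≤ r := by exact_mod_cast hr
      have hlog : (L : ℝ) * Real.log 2 ≤ Real.log r := by
        rw [← Real.log_pow]
        exact Real.log_le_log (by positivity) (by exact_mod_cast hL)
      have hlog2 : Real.log 2 ≤ Real.log r := Real.log_le_log (by norm_num) hr'
      have hl2 := Real.log_two_gt_d9
      -- Both `L` and `1` are at most `log r / log 2`, and `log 2 > 1 / 2`. The factor `4` becomes
      -- `2` under the root, whence `726 = 2 * 363`.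
      have hL1 : (L : ℝ) + 1 ≤ 4 * Real.log r := by
        have hL0 : (0 : ℝ) ≤ L := Nat.cast_nonneg L
        nlinarith
      push_cast
      refine max_le (by linarith) ?_
      calc (r : ℝ) * (L + 1) ≤ r * (4 * Real.log r) := by gcongr
        _ = 4 * (r * Real.log r) := by ring
        _ ≤ 4 * w := by gcongr; exact le_max_right _ _
  have h' : ((k : ℝ) * p) ^ 2 ≤ (726 * n * q * Real.sqrt w) ^ 2 := by
    have h1 : ((k : ℝ) * p) ^ 2 ≤ (363 * n * q) ^ 2 * ((max 1 (r * (L + 1)) : ℕ) : ℝ) := by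
      exact_mod_cast h
    calc ((k : ℝ) * p) ^ 2 ≤ _ := h1
      _ ≤ (363 * n * q) ^ 2 * (4 * w) := by gcongr
      _ = (726 * n * q) ^ 2 * w := by ring
      _ = (726 * n * q) ^ 2 * Real.sqrt w ^ 2 := by rw [Real.sq_sqrt (by linarith)]
      _ = _ := by ring
  have h2 := le_of_sq_le_sq h' (by positivity)
  rw [div_div_eq_mul_div, ← mul_div_assoc, le_div_iff₀ hp']
  linarith

open SearchTable in
theorem theorem1 :
    ∃ (A : OracleAlgorithm) (C : ℝ),
      ∀ (n p q : ℕ) (_hp : 0 < p) (_hq : 0 < q) (ε : ℝ) (_hε : ε = (p : ℝ) / (q : ℝ))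
        (M₁ M₂ : Matroid (Fin n)) (_hM₁ : M₁.E = Set.univ) (_hM₂ : M₂.E = Set.univ)
        (r : ℕ) (_hr : IsMaxCommonIndepSize M₁ M₂ r),
        ∃ (k : ℕ) (S : Finset (Fin n)),
          A.RunsTo p q M₁ M₂ [] k S ∧
          M₁.Indep (S : Set (Fin n)) ∧ M₂.Indep (S : Set (Fin n)) ∧
          (1 - ε) * (r : ℝ) ≤ (S.card : ℝ) ∧
          (k : ℝ) ≤ C * ((n : ℝ) * Real.sqrt (max 1 ((r : ℝ) * Real.log (r : ℝ))) / ε) := by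
  classical
  refine ⟨algorithm exists_test_eq_true, 726, ?_⟩
  rintro n p q hp hq ε rfl M₁ M₂ hE₁ hE₂ r ⟨⟨I, hI₁, hI₂, rfl⟩, hr⟩
  have hfound : test (n, p, q) (find exists_test_eq_true (n, p, q)) = true :=
    Nat.find_spec (exists_test_eq_true (n, p, q))
  set i := find exists_test_eq_true (n, p, q) with hi
  have hpq : p * q ≠ 0 := (Nat.mul_pos hp hq).ne'
  obtain ⟨y, hy, hcheck⟩ : ∃ y, Encodable.decode (α := List OracleAction × ℕ) i = some y ∧
      Check (n, p, q) y := by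
    rw [test, Bool.or_eq_true, decide_eq_true_iff] at hfound
    have hf := hfound.resolve_left hpq
    cases hd : Encodable.decode (α := List OracleAction × ℕ) i with
    | none => rw [hd] at hf; simp at hf
    | some y =>
      rw [hd, Option.elim_some, decide_eq_true_iff] at hf
      exact ⟨y, rfl, hf⟩
  obtain ⟨T, N⟩ := y
  obtain ⟨m₁, hm₁, hc₁⟩ := exists_codes M₁
  obtain ⟨m₂, hm₂, hc₂⟩ := exists_codes M₂
  -- The table found need not come from `solve`; its guarantees follow from the check at the codes
  -- of the given matroids.
  obtain ⟨hout, c, hc, b₁, b₂, hl, b, hb, d₁, d₂, hmax, hacc, L, -, hL, hcost⟩ :=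
    hcheck m₁ hm₁ m₂ hm₂ ⟨hc₁.isMatroidCode hE₁, hc₂.isMatroidCode hE₂⟩
  simp only at hout hc hl hb hmax hacc hL hcost
  have hA : ∀ h, (algorithm exists_test_eq_true).next ((n, p, q), h) = act T h := by
    intro h
    change act (tableOf i) h = act T h
    rw [tableOf, hy, Option.getD_some]
  obtain ⟨k, hk, hrun⟩ := runsTo_of_isOutput hc₁ hc₂ hA N [] hout
  rw [List.length_nil, zero_add] at hk
  rw [← lists_iff.1 hl] at hrun
  have hbI : size n b = I.card := by
    refine le_antisymm ?_ ?_
    · rw [size_eq]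
      exact hr ⟨setOf n b, (hc₁ b hb).1 d₁, (hc₂ b hb).1 d₂, rfl⟩
    · obtain ⟨c', hc', he⟩ := exists_setOf_eq I
      have := hmax c' hc' ⟨(hc₁ c' hc').2 (he ▸ hI₁), (hc₂ c' hc').2 (he ▸ hI₂)⟩
      rwa [size_eq, he] at this
  rw [hbI] at hacc hL hcost
  rw [hk] at hcost
  refine ⟨k, setOf n c, hrun, (hc₁ c hc).1 b₁, (hc₂ c hc).1 b₂, ?_, queries_le hp hq hL hcost⟩
  rw [size_eq] at hacc
  have hq' : (0 : ℝ) < q := by exact_mod_cast hq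
  have hacc' : (q : ℝ) * I.card ≤ q * (setOf n c).card + p * I.card := by exact_mod_cast hacc
  rw [one_sub_div hq'.ne', div_mul_eq_mul_div, div_le_iff₀ hq']
  linarith
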